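/- Let $p$ be an odd prime, $s_1,s_2\ge 1$ integers, $q_i=p^{s_i}$, $s=s_1+s_2$, and let $\mathrm{Tr}_1^{s_i}:\mathbb{F}_{q_i}\to\mathbb{F}_p$ be the trace. Let $f:\mathbb{F}_{q_1}\to\mathbb{F}_p$ be a nonzero quadratic form over $\mathbb{F}_p$ (degenerate or not), $F(x,y)=\frac12\big(f(x+y)-f(x)-f(y)\big)$, let $v_1,\dots,v_{s_1}$ be a basis of $\mathbb{F}_{q_1}$ over $\mathbb{F}_p$ and $A=(F(v_i,v_j))_{i,j}$. The rank of $f$ is $R_f=\operatorname{rank}A$; if $M$ is invertible over $\mathbb{F}_p$ and $MAM^T$ is diagonal, the sign $\varepsilon_f\in\{\pm1\}$ of $f$ is the quadratic character of $\mathbb{F}_p$ evaluated at the product of the nonzero diagonal entries of $MAM^T$ (it does not depend on the choices). Let $\alpha\in\mathbb{F}_{q_2}^*$, $$D=\{(x,y)\in(\mathbb{F}_{q_1}\times\mathbb{F}_{q_2})\setminus\{(0,0)\}: f(x)+\mathrm{Tr}_1^{s_2}(\alpha y)=0\},$$ $$C_D=\Big\{\big(\mathrm{Tr}_1^{s_1}(ux)+\mathrm{Tr}_1^{s_2}(vy)\big)_{(x,y)\in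 D}:(u,v)\in\mathbb{F}_{q_1}\times\mathbb{F}_{q_2}\Big\},$$ and $p^*=(-1)^{(p-1)/2}p$. Then $C_D$ is a linear code over $\mathbb{F}_p$ of length $|D|=p^{s-1}-1$ and dimension $s$, and its weight distribution is as follows, where every weight that occurs is listed and $A_\omega$ is the number of codewords of Hamming weight $\omega$. (1) If $R_f$ is odd: $$\begin{array}{ll} \omega & A_\omega\\ \hline 0 & 1\\ (p-1)p^{s-2} & p^s-p^{R_f-1}(p-1)^2-1\\ p^{s-2}\big(p-1-p^{-\frac{R_f-1}{2}}\big) & \frac12(p-1)^2p^{R_f-1}\big(1+p^{-\frac{R_f-1}{2}}\big)\\ p^{s-2}\big(p-1+p^{-\frac{R_f-1}{2}}\big) & \frac12(p-1)^2p^{R_f-1}\big(1-p^{-\frac{R_f-1}{2}}\big) \end{array}$$ (2) If $R_f$ is even: $$\begin{array}{ll} \omega & A_\omega\\ \hline 0 & 1\\ p^{s-2}(p-1) & p^s-p^{R_f}(p-1)-1\\ p^{s-2}(p-1)\big(1-\varepsilon_f(p^*)^{-\frac{R_f}{2}}\big) & (p-1)p^{R_f-1}\big(1+\varepsilon_f(p-1)(p^*)^{-\frac{R_f}{2}}\big)\\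 p^{s-2}\big(p-1+\varepsilon_f(p^*)^{-\frac{R_f}{2}}\big) & (p-1)^2p^{R_f-1}\big(1-\varepsilon_f(p^*)^{-\frac{R_f}{2}}\big) \end{array}$$ If moreover $R_f\ge 2$, then $C_D$ is a three-weight code: exactly three nonzero weights occur. (If $R_f=1$, the last row of the table in (1) has multiplicity $0$.) -/

import Mathlib

noncomputable section

/-- The symmetric bilinear form `F(x, y) = (f(x + y) - f(x) - f(y)) / 2` of a quadratic form `f`. -/
def halfPolar {p : ℕ} [Fact p.Prime] {V : Type*} [AddCommGroup V] [Module (ZMod p) V]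
    (f : QuadraticForm (ZMod p) V) (x y : V) : ZMod p :=
  2⁻¹ * (f (x + y) - f x - f y)

/-- The matrix `A = (F(v_i, v_j))` of a quadratic form in the basis `v`. -/
def formMatrix {p : ℕ} [Fact p.Prime] {V : Type*} [AddCommGroup V] [Module (ZMod p) V] {m : ℕ}
    (f : QuadraticForm (ZMod p) V) (v : Module.Basis (Fin m) (ZMod p) V) :
    Matrix (Fin m) (Fin m) (ZMod p) :=
  Matrix.of fun i j => halfPolar f (v i) (v j)

/-- The rank `R_f` of a quadratic form. -/
def formRank {p : ℕ} [Fact p.Prime] {V : Type*} [AddCommGroup V] [Module (ZMod p) V] {m : ℕ}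
    (f : QuadraticForm (ZMod p) V) (v : Module.Basis (Fin m) (ZMod p) V) : ℕ :=
  (formMatrix f v).rank

/-- `ε` is the quadratic character of the product of the nonzero entries of a diagonal matrix
`M A Mᵀ` with `M` invertible (the empty product is `1`). -/
def IsMatrixSign {p : ℕ} [Fact p.Prime] {m : ℕ} (A : Matrix (Fin m) (Fin m) (ZMod p)) (ε : ℤ) :
    Prop :=
  ∃ (M : Matrix (Fin m) (Fin m) (ZMod p)) (l : Fin m → ZMod p),
    IsUnit M ∧ M * A * M.transpose = Matrix.diagonal l ∧
      ε = quadraticChar (ZMod p) (∏ i with l i ≠ 0, l i)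

open Classical in
/-- The sign `ε_f` of a quadratic form. For `p ≠ 2` a sign exists and is unique, see
`exists_isMatrixSign` and `IsMatrixSign.unique` below. -/
def formSign {p : ℕ} [Fact p.Prime] {V : Type*} [AddCommGroup V] [Module (ZMod p) V] {m : ℕ}
    (f : QuadraticForm (ZMod p) V) (v : Module.Basis (Fin m) (ZMod p) V) : ℤ :=
  if h : ∃ ε, IsMatrixSign (formMatrix f v) ε then h.choose else 0

theorem exists_isMatrixSign {p : ℕ} [Fact p.Prime] (hp : p ≠ 2) {V : Type*} [AddCommGroup V]
    [Module (ZMod p) V] {m : ℕ} (f : QuadraticForm (ZMod p) V)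
    (v : Module.Basis (Fin m) (ZMod p) V) : ∃ ε, IsMatrixSign (formMatrix f v) ε := by
  have h2 : (2 : ZMod p) ≠ 0 := by
    intro h
    have h' : ((2 : ℕ) : ZMod p) = 0 := by exact_mod_cast h
    rw [ZMod.natCast_eq_zero_iff] at h'
    exact hp ((Nat.prime_dvd_prime_iff_eq (Fact.out : p.Prime) Nat.prime_two).1 h')
  let _ : Invertible (2 : ZMod p) := invertibleOfNonzero h2
  have : Module.Finite (ZMod p) V := Module.Finite.of_basis v
  let B : LinearMap.BilinForm (ZMod p) V := QuadraticMap.associated f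
  have hB : ∀ x y, B x y = halfPolar f x y := by
    intro x y
    have h := LinearMap.congr_fun
      (LinearMap.congr_fun (QuadraticMap.two_nsmul_associated (ZMod p) f) x) y
    apply mul_left_cancel₀ h2
    rw [halfPolar, mul_inv_cancel_left₀ h2]
    simpa [B, QuadraticMap.polar, two_mul, two_nsmul] using h
  have hA : formMatrix f v = LinearMap.BilinForm.toMatrix v B := by
    ext i j
    simp [formMatrix, LinearMap.BilinForm.toMatrix_apply, hB]
  have hsymm : LinearMap.IsSymm B :=
    ⟨fun x y => QuadraticMap.associated_isSymm (ZMod p) f x y⟩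
  obtain ⟨w', hw'⟩ := LinearMap.BilinForm.exists_orthogonal_basis hsymm
  have hm : Module.finrank (ZMod p) V = m := by simp [Module.finrank_eq_card_basis v]
  let w := w'.reindex (finCongr hm)
  refine ⟨_, (v.toMatrix w).transpose, fun i => B (w i) (w i), ?_, ?_, rfl⟩
  · rw [Matrix.isUnit_transpose]
    exact (Matrix.isUnit_iff_isUnit_det _).2
      (by
        have h := congrArg Matrix.det (v.toMatrix_mul_toMatrix_flip w)
        rw [Matrix.det_mul, Matrix.det_one] at h
        exact IsUnit.of_mul_eq_one _ h)
  · rw [hA, Matrix.transpose_transpose, LinearMap.BilinForm.toMatrix_mul_basis_toMatrix]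
    ext i j
    rw [LinearMap.BilinForm.toMatrix_apply, Matrix.diagonal_apply]
    split_ifs with hij
    · rw [hij]
    · have := hw' (i := (finCongr hm).symm i) (j := (finCongr hm).symm j) (by simpa using hij)
      simpa [w] using this

theorem IsMatrixSign.unique {p : ℕ} [Fact p.Prime] {m : ℕ}
    {A : Matrix (Fin m) (Fin m) (ZMod p)} {ε ε' : ℤ} (h : IsMatrixSign A ε)
    (h' : IsMatrixSign A ε') : ε = ε' := by
  classical
  obtain ⟨M, l, hM, hl, rfl⟩ := h
  obtain ⟨N, k, hN, hk, rfl⟩ := h'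
  have hMd := (Matrix.isUnit_iff_isUnit_det _).1 hM
  have hNd := (Matrix.isUnit_iff_isUnit_det _).1 hN
  have hMtd : IsUnit M.transpose.det := by rwa [Matrix.det_transpose]
  have hNtd : IsUnit N.transpose.det := by rwa [Matrix.det_transpose]
  have hcard : Fintype.card {i // l i ≠ 0} = Fintype.card {i // k i ≠ 0} := by
    rw [← Matrix.rank_diagonal l, ← Matrix.rank_diagonal k, ← hl, ← hk,
      Matrix.rank_mul_eq_left_of_isUnit_det _ _ hMtd,
      Matrix.rank_mul_eq_right_of_isUnit_det _ _ hMd,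
      Matrix.rank_mul_eq_left_of_isUnit_det _ _ hNtd,
      Matrix.rank_mul_eq_right_of_isUnit_det _ _ hNd]
  let e := Fintype.equivOfCardEq hcard
  have hP : (N * M⁻¹) * Matrix.diagonal l * (N * M⁻¹).transpose = Matrix.diagonal k := by
    rw [← hl, ← hk, Matrix.transpose_mul]
    have h1 : M⁻¹ * M = 1 := Matrix.nonsing_inv_mul _ hMd
    have h2 : M.transpose * M⁻¹.transpose = 1 := by
      rw [← Matrix.transpose_mul, h1, Matrix.transpose_one]
    calc N * M⁻¹ * (M * A * M.transpose) * (M⁻¹.transpose * N.transpose)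
        = N * (M⁻¹ * M) * A * (M.transpose * M⁻¹.transpose) * N.transpose := by
          simp only [Matrix.mul_assoc]
      _ = _ := by rw [h1, h2]; simp
  let a : Matrix {i // l i ≠ 0} {i // l i ≠ 0} (ZMod p) :=
    Matrix.of fun i j => (N * M⁻¹) (e i) j
  have ha : a * Matrix.diagonal (fun i : {i // l i ≠ 0} => l i) * a.transpose
      = Matrix.diagonal (fun i : {i // l i ≠ 0} => k (e i)) := by
    ext i j
    have h3 := congrFun (congrFun hP (e i)) (e j)
    rw [Matrix.mul_apply] at h3 ⊢
    simp only [Matrix.mul_diagonal, Matrix.transpose_apply] at h3 ⊢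
    have h4 : ∑ x : {i // l i ≠ 0}, a i x * l x * a j x
        = ∑ x, (N * M⁻¹) (e i) x * l x * (N * M⁻¹) (e j) x := by
      have h5 := Finset.sum_subtype (F := inferInstance) (Finset.univ.filter fun i => l i ≠ 0) (p := fun i => l i ≠ 0)
        (by simp) (fun x => (N * M⁻¹) (e i) x * l x * (N * M⁻¹) (e j) x)
      rw [Finset.sum_filter_of_ne] at h5
      · exact h5.symm
      · intro x _ hx h0
        exact hx (by simp [h0])
    rw [h4, h3]
    simp [Matrix.diagonal_apply, Subtype.ext_iff.symm]
  have hdet := congrArg Matrix.det ha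
  rw [Matrix.det_mul, Matrix.det_mul, Matrix.det_transpose, Matrix.det_diagonal,
    Matrix.det_diagonal, e.prod_comp (fun i : {i // k i ≠ 0} => k i)] at hdet
  have hL : ∏ i with l i ≠ 0, l i = ∏ i : {i // l i ≠ 0}, l i :=
    Finset.prod_subtype _ (by simp) _
  have hK : ∏ i with k i ≠ 0, k i = ∏ i : {i // k i ≠ 0}, k i :=
    Finset.prod_subtype _ (by simp) _
  have hK0 : ∏ i : {i // k i ≠ 0}, k i ≠ 0 := Finset.prod_ne_zero_iff.2 fun i _ => i.2
  have ha0 : a.det ≠ 0 := by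
    intro h0
    rw [h0] at hdet
    exact hK0 (by simpa using hdet.symm)
  rw [hL, hK, ← hdet, map_mul, map_mul, mul_right_comm, ← map_mul, ← sq,
    quadraticChar_sq_one' ha0, one_mul]

/-- The number `A_i` of codewords of Hamming weight `i` in the code `C`. -/
def weightCount {p : ℕ} {ι : Type*} [Fintype ι] (C : Submodule (ZMod p) (ι → ZMod p)) (i : ℕ) :
    ℕ :=
  Nat.card {c : C // hammingNorm (c : ι → ZMod p) = i}

/-- `C` has exactly `t` nonzero weights. -/
def IsTWeightCode {p : ℕ} {ι : Type*} [Fintype ι] (C : Submodule (ZMod p) (ι → ZMod p)) (t : ℕ) :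
    Prop :=
  {i : ℕ | i ≠ 0 ∧ weightCount C i ≠ 0}.ncard = t

/-- The weight distribution of `C` is given by the table `T` of pairs (weight, multiplicity):
each row of the table is correct, and no weight outside the table occurs. -/
def HasWeightTable {p : ℕ} {ι : Type*} [Fintype ι] (C : Submodule (ZMod p) (ι → ZMod p))
    (T : List (ℚ × ℚ)) : Prop :=
  (∀ r ∈ T, ∃ i : ℕ, (i : ℚ) = r.1 ∧ (weightCount C i : ℚ) = r.2) ∧
    ∀ i : ℕ, weightCount C i ≠ 0 → ∃ r ∈ T, r.1 = (i : ℚ)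

/-- The map sending `X = (x₁, x₂)` to the word `(Tr(x₁ y₁) + Tr(x₂ y₂))`, `(y₁, y₂) ∈ D`. -/
def codewordMap {p : ℕ} [Fact p.Prime] {K₁ K₂ : Type*} [Field K₁] [Field K₂]
    [Algebra (ZMod p) K₁] [Algebra (ZMod p) K₂] (D : Finset (K₁ × K₂)) :
    K₁ × K₂ →ₗ[ZMod p] (D → ZMod p) where
  toFun X Y :=
    Algebra.trace (ZMod p) K₁ (X.1 * Y.1.1) + Algebra.trace (ZMod p) K₂ (X.2 * Y.1.2)
  map_add' X X' := by
    funext Y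
    simp only [Prod.fst_add, Prod.snd_add, add_mul, map_add, Pi.add_apply]
    ring
  map_smul' c X := by
    funext Y
    simp [mul_add]

/-- The linear code `C_D` with defining set `D`. -/
def definingCode {p : ℕ} [Fact p.Prime] {K₁ K₂ : Type*} [Field K₁] [Field K₂]
    [Algebra (ZMod p) K₁] [Algebra (ZMod p) K₂] (D : Finset (K₁ × K₂)) :
    Submodule (ZMod p) (D → ZMod p) :=
  LinearMap.range (codewordMap D)

open Classical in
/-- The defining set `D = {(x, y) ≠ (0, 0) : f(x) + Tr(α y) = 0}`. -/
def definingSet {p : ℕ} [Fact p.Prime] {K₁ K₂ : Type*} [Field K₁] [Field K₂] [Fintype K₁]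
    [Fintype K₂] [Algebra (ZMod p) K₁] [Algebra (ZMod p) K₂] (f : QuadraticForm (ZMod p) K₁)
    (α : K₂) : Finset (K₁ × K₂) :=
  Finset.univ.filter fun z =>
    z ≠ (0, 0) ∧ f z.1 + Algebra.trace (ZMod p) K₂ (α * z.2) = 0

/-- `p* = (-1)^((p - 1) / 2) p` for an odd prime `p`. -/
def pStar (p : ℕ) : ℚ := (-1) ^ ((p - 1) / 2) * p

/-- The rows (weight, multiplicity) for odd rank `R`; here `(R - 1) / 2` is an exact division. -/
def oddTable (p s R : ℕ) : List (ℚ × ℚ) :=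
  let q : ℚ := p
  let t : ℚ := (q ^ ((R - 1) / 2))⁻¹
  [(0, 1),
   ((q - 1) * q ^ (s - 2), q ^ s - q ^ (R - 1) * (q - 1) ^ 2 - 1),
   (q ^ (s - 2) * (q - 1 - t), 1 / 2 * (q - 1) ^ 2 * q ^ (R - 1) * (1 + t)),
   (q ^ (s - 2) * (q - 1 + t), 1 / 2 * (q - 1) ^ 2 * q ^ (R - 1) * (1 - t))]

/-- The rows (weight, multiplicity) for even rank `R ≥ 2` and sign `ε`; here `R / 2` is an exact
division. -/
def evenTable (p s R : ℕ) (ε : ℤ) : List (ℚ × ℚ) :=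
  let q : ℚ := p
  let t : ℚ := ε * (pStar p ^ (R / 2))⁻¹
  [(0, 1),
   (q ^ (s - 2) * (q - 1), q ^ s - q ^ R * (q - 1) - 1),
   (q ^ (s - 2) * (q - 1) * (1 - t), (q - 1) * q ^ (R - 1) * (1 + (q - 1) * t)),
   (q ^ (s - 2) * (q - 1 + t), (q - 1) ^ 2 * q ^ (R - 1) * (1 - t))]

end

/-!
The weight of the codeword of `(u, v)` is `p^(s-1)` minus the number of points of the hypersurface
`f(x) + Tr(α y) = 0` on which `Tr(u x) + Tr(v y)` vanishes. If `v` is not a multiple of `α`, the two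
conditions on `y` are independent for each `x`, and the number is the average `p^(s-2)`. If
`v = c α`, the conditions combine to `c f(x) = Tr(u x)`, each solution `x` of which extends in
`p^(s₂-1)` ways. For `c = 0` this is one linear equation. For `c ≠ 0`, choose coordinates with
`f = ∑ l_i z_i²` (`exists_diagonal_coordinates`) and let `b` be the coefficients of the linear form
`c⁻¹ Tr(u ·)`; the equation becomes the affine quadric `∑ (l_i z_i² - b_i z_i) = 0`.

The points of such a quadric are counted with additive characters (`card_diagonal_quadric`). Every
character sum factors over the coordinates. If `b_i ≠ 0` for some `i` with `l_i = 0`, one factor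
vanishes and the number of points is the average. Otherwise the coordinates with `l_i ≠ 0` give
quadratic Gauss sums, and the deviation from the average depends only on `a = ∑ b_i² / (4 l_i)`
(sum over `l_i ≠ 0`) through the integer `gaussDeviation`: for even rank it distinguishes `a = 0`
from `a ≠ 0`, for odd rank zero, squares and nonsquares.

The multiplicities come from the same count: `a` is itself a nondegenerate diagonal quadratic form
in `b`, with the discriminant of `f` up to squares (`card_dual_quadric`), so a value of `a` whose
normalized deviation is `ρ` is taken by `p^(R-1) (1 + ρ)` vectors `b`. As `(c, b)` determines
`(u, v)` (`exceptionalPair`), counting the pairs `(c, b)` gives the table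
(`hasWeightTable_definingCode`). All weights of nonzero messages being positive, the
encoding is injective, which gives the dimension.
-/

noncomputable section

/-! ### Character sums of diagonal quadratic polynomials -/

theorem addChar_sum_eq_prod {A R ι : Type*} [AddCommMonoid A] [CommMonoid R] (ψ : AddChar A R)
    (s : Finset ι) (a : ι → A) : ψ (∑ i ∈ s, a i) = ∏ i ∈ s, ψ (a i) := by
  classical
  induction s using Finset.induction_on with
  | empty => simp
  | insert i s hi ih => rw [Finset.sum_insert hi, Finset.prod_insert hi, ψ.map_add_eq_mul, ih]

open Finset in
/-- As `t` has `1 + η(t)` square roots, the quadratic exponential sum is a Gauss sum. -/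
theorem sum_addChar_mul_sq {F : Type*} [Field F] [Fintype F] [DecidableEq F] (hF : ringChar F ≠ 2)
    {ψ : AddChar F ℂ} (hψ : ψ.IsPrimitive) {b : F} (hb : b ≠ 0) :
    ∑ x, ψ (b * x ^ 2) =
      quadraticChar F b * gaussSum ((quadraticChar F).ringHomComp (Int.castRingHom ℂ)) ψ := by
  have h1 : ∑ x, ψ (b * x ^ 2) = ∑ t, ((quadraticChar F t : ℂ) + 1) * ψ (b * t) := by
    rw [← Finset.sum_fiberwise univ (fun x : F => x ^ 2)]
    refine Finset.sum_congr rfl fun t _ => ?_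
    have h2 : ∀ x ∈ univ.filter (fun x : F => x ^ 2 = t), ψ (b * x ^ 2) = ψ (b * t) := by
      intro x hx
      rw [(Finset.mem_filter.1 hx).2]
    rw [Finset.sum_congr rfl h2, Finset.sum_const, nsmul_eq_mul]
    have h3 := quadraticChar_card_sqrts hF t
    rw [Set.toFinset_ofPred] at h3
    congr 1
    exact_mod_cast congrArg (Int.cast : ℤ → ℂ) h3
  have h4 : ∑ t, ψ (b * t) = 0 := by
    have := AddChar.sum_mulShift b hψ
    simp only [hb, if_false, Nat.cast_zero] at this
    simpa only [mul_comm] using this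
  simp only [add_mul, one_mul, Finset.sum_add_distrib] at h1
  rw [h1, h4, add_zero]
  have h5 := gaussSum_mulShift ((quadraticChar F).ringHomComp (Int.castRingHom ℂ)) ψ
    (Units.mk0 b hb)
  rw [← h5, ← mul_assoc, MulChar.ringHomComp_apply]
  have h6 : ((quadraticChar F b : ℤ) : ℂ) * (quadraticChar F b : ℤ) = 1 := by
    rw [← sq]; exact_mod_cast quadraticChar_sq_one hb
  simp only [Units.val_mk0, eq_intCast, h6, one_mul]
  simp [gaussSum, AddChar.mulShift_apply]

/-- Completing the square reduces to the homogeneous case. -/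
theorem sum_addChar_quadratic {F : Type*} [Field F] [Fintype F] [DecidableEq F]
    (hF : ringChar F ≠ 2) {ψ : AddChar F ℂ} (hψ : ψ.IsPrimitive) {y l : F} (hy : y ≠ 0)
    (hl : l ≠ 0) (b : F) :
    ∑ x, ψ (y * (l * x ^ 2 - b * x)) =
      ψ (-y * (b ^ 2 / (4 * l))) * (quadraticChar F y * quadraticChar F l *
        gaussSum ((quadraticChar F).ringHomComp (Int.castRingHom ℂ)) ψ) := by
  have h2 : (2 : F) ≠ 0 := Ring.two_ne_zero hF
  have h4 : (4 : F) ≠ 0 := by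
    have : (4 : F) = 2 * 2 := by norm_num
    rw [this]; exact mul_ne_zero h2 h2
  rw [← Int.cast_mul, ← map_mul, ← sum_addChar_mul_sq hF hψ (mul_ne_zero hy hl), Finset.mul_sum,
    ← Equiv.sum_comp (Equiv.addRight (b / (2 * l)))]
  refine Finset.sum_congr rfl fun x _ => ?_
  rw [← AddChar.map_add_eq_mul, Equiv.coe_addRight]
  congr 1
  field_simp
  ring

theorem sum_addChar_linear {F : Type*} [Field F] [Fintype F] [DecidableEq F]
    {ψ : AddChar F ℂ} (hψ : ψ.IsPrimitive) {y : F} (hy : y ≠ 0) (b : F) :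
    ∑ x, ψ (y * (0 * x ^ 2 - b * x)) = if b = 0 then (Fintype.card F : ℂ) else 0 := by
  have := AddChar.sum_mulShift (-(y * b)) hψ
  simp only [neg_eq_zero, mul_eq_zero, hy, false_or, Nat.cast_ite, Nat.cast_zero] at this
  rw [← this]
  refine Finset.sum_congr rfl fun x _ => ?_
  congr 1
  ring

/-- The character sum of a diagonal quadratic polynomial: it factors over the variables, each
factor being a quadratic Gauss sum (`l i ≠ 0`) or a sum of an additive character (`l i = 0`). -/
theorem sum_addChar_diagonal {F : Type*} [Field F] [Fintype F] [DecidableEq F]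
    {ι : Type*} [Fintype ι] [DecidableEq ι]
    (hF : ringChar F ≠ 2) {ψ : AddChar F ℂ} (hψ : ψ.IsPrimitive) {y : F} (hy : y ≠ 0)
    (l b : ι → F) :
    ∑ z : ι → F, ψ (y * ∑ i, (l i * z i ^ 2 - b i * z i)) =
      if ∀ i, l i = 0 → b i = 0 then
        (Fintype.card F : ℂ) ^ (Finset.univ.filter fun i => l i = 0).card *
          (ψ (-y * ∑ i, b i ^ 2 / (4 * l i)) *
            (((quadraticChar F y : ℂ) *
                gaussSum ((quadraticChar F).ringHomComp (Int.castRingHom ℂ)) ψ) ^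
              (Finset.univ.filter fun i => l i ≠ 0).card *
            quadraticChar F (∏ i with l i ≠ 0, l i)))
      else 0 := by
  have h1 : ∀ z : ι → F, ψ (y * ∑ i, (l i * z i ^ 2 - b i * z i)) =
      ∏ i, ψ (y * (l i * z i ^ 2 - b i * z i)) := by
    intro z
    rw [Finset.mul_sum, addChar_sum_eq_prod]
  simp only [h1]
  rw [← Fintype.prod_sum (fun i x => ψ (y * (l i * x ^ 2 - b i * x)))]
  split_ifs with hb
  · rw [← Finset.prod_filter_mul_prod_filter_not Finset.univ (fun i => l i = 0)]
    congr 1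
    · rw [← Finset.prod_const]
      refine Finset.prod_congr rfl fun i hi => ?_
      have hi' := (Finset.mem_filter.1 hi).2
      rw [hi', sum_addChar_linear hψ hy, if_pos (hb i hi')]
    · have h2 : ψ (-y * ∑ i, b i ^ 2 / (4 * l i)) =
          ∏ i with l i ≠ 0, ψ (-y * (b i ^ 2 / (4 * l i))) := by
        rw [Finset.mul_sum, addChar_sum_eq_prod, Finset.prod_filter]
        refine Finset.prod_congr rfl fun i _ => ?_
        split_ifs with h
        · rfl
        · rw [not_not.1 h]; simp
      rw [h2, map_prod, Int.cast_prod, ← Finset.prod_const, ← Finset.prod_mul_distrib,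
        ← Finset.prod_mul_distrib]
      refine Finset.prod_congr rfl fun i hi => ?_
      rw [sum_addChar_quadratic hF hψ hy (Finset.mem_filter.1 hi).2]
      ring
  · push Not at hb
    obtain ⟨i, hi, hbi⟩ := hb
    refine Finset.prod_eq_zero (Finset.mem_univ i) ?_
    rw [hi, sum_addChar_linear hψ hy, if_neg hbi]

/-- The deviation, up to a power of the order `q` of `F`, of the number of zeros of a quadratic
polynomial from its mean value: the integer `∑_{y ≠ 0} η(y)^R η(d) g^R ψ(-yc)`, where `η` is the
quadratic character, `ψ` a nontrivial additive character and `g` their Gauss sum, written out with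
`g² = η(-1) q`. Here `R` is the rank of the quadratic part, `d` the discriminant of its
nondegenerate part, and `c` the value to be represented once the square is completed. -/
def gaussDeviation (F : Type*) [Field F] [Fintype F] [DecidableEq F] (R : ℕ) (d c : F) : ℤ :=
  if Even R then
    quadraticChar F d * (quadraticChar F (-1) * Fintype.card F) ^ (R / 2) *
      (if c = 0 then (Fintype.card F : ℤ) - 1 else -1)
  else
    quadraticChar F d * (quadraticChar F (-1) * Fintype.card F) ^ ((R + 1) / 2) *
      quadraticChar F (-c)

theorem sum_ne_zero_eq_gaussDeviation {F : Type*} [Field F] [Fintype F] [DecidableEq F]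
    (hF : ringChar F ≠ 2) {ψ : AddChar F ℂ} (hψ : ψ.IsPrimitive) (R : ℕ) (d c : F) :
    ∑ y ∈ Finset.univ.erase (0 : F), ψ (-y * c) *
        (((quadraticChar F y : ℂ) *
            gaussSum ((quadraticChar F).ringHomComp (Int.castRingHom ℂ)) ψ) ^ R *
          quadraticChar F d) = gaussDeviation F R d c := by
  set χ := (quadraticChar F).ringHomComp (Int.castRingHom ℂ) with hχ
  have hχ1 : χ ≠ 1 := by
    rw [hχ, Ne, MulChar.ringHomComp_eq_one_iff (RingHom.injective_int _)]
    exact quadraticChar_ne_one hF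
  have hg : gaussSum χ ψ ^ 2 = (quadraticChar F (-1) : ℂ) * Fintype.card F := by
    rw [gaussSum_sq hχ1 ((quadraticChar_isQuadratic F).comp _) hψ]
    simp [hχ, MulChar.ringHomComp_apply]
  have hψ0 : ∑ y : F, ψ (-y * c) = if c = 0 then (Fintype.card F : ℂ) else 0 := by
    have := AddChar.sum_mulShift (-c) hψ
    simp only [neg_eq_zero, Nat.cast_ite, Nat.cast_zero] at this
    rw [← this]
    exact Finset.sum_congr rfl fun x _ => by congr 1; ring
  have hη : ∀ y ∈ Finset.univ.erase (0 : F), (quadraticChar F y : ℂ) ^ 2 = 1 := by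
    intro y hy
    exact_mod_cast quadraticChar_sq_one (Finset.ne_of_mem_erase hy)
  unfold gaussDeviation
  by_cases hR : Even R
  · rw [if_pos hR]
    obtain ⟨k, rfl⟩ := hR
    rw [← two_mul, Nat.mul_div_cancel_left _ two_pos]
    have h1 : ∀ y ∈ Finset.univ.erase (0 : F), ψ (-y * c) *
        (((quadraticChar F y : ℂ) * gaussSum χ ψ) ^ (2 * k) * quadraticChar F d) =
        ψ (-y * c) * (((quadraticChar F (-1) : ℂ) * Fintype.card F) ^ k * quadraticChar F d) := by
      intro y hy
      rw [pow_mul, mul_pow, hη y hy, one_mul, hg]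
    rw [Finset.sum_congr rfl h1, ← Finset.sum_mul,
      Finset.sum_erase_eq_sub (Finset.mem_univ _), hψ0]
    push_cast
    split_ifs
    all_goals simp
    all_goals ring
  · rw [if_neg hR]
    obtain ⟨k, rfl⟩ := Nat.not_even_iff_odd.1 hR
    rw [show (2 * k + 1 + 1) / 2 = k + 1 by omega]
    have h1 : ∀ y ∈ Finset.univ.erase (0 : F), ψ (-y * c) *
        (((quadraticChar F y : ℂ) * gaussSum χ ψ) ^ (2 * k + 1) * quadraticChar F d) =
        (quadraticChar F y * ψ (-y * c)) * (((quadraticChar F (-1) : ℂ) * Fintype.card F) ^ k *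
          (gaussSum χ ψ * quadraticChar F d)) := by
      intro y hy
      rw [pow_succ, pow_mul, mul_pow, hη y hy, one_mul, hg]
      ring
    have h2 : ∑ y : F, (quadraticChar F y : ℂ) * ψ (-y * c) =
        quadraticChar F (-c) * gaussSum χ ψ := by
      by_cases hc : c = 0
      · have := quadraticChar_sum_zero hF
        simp only [hc, mul_zero, AddChar.map_zero_eq_one, mul_one, neg_zero, MulChar.map_zero,
          Int.cast_zero, zero_mul]
        exact_mod_cast this
      · have hc' : -c ≠ 0 := neg_ne_zero.2 hc
        have h5 := gaussSum_mulShift χ ψ (Units.mk0 (-c) hc')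
        have h6 := hη _ (Finset.mem_erase.2 ⟨hc', Finset.mem_univ _⟩)
        rw [← h5, ← mul_assoc, hχ, MulChar.ringHomComp_apply]
        simp only [Units.val_mk0, eq_intCast]
        rw [← sq, h6, one_mul]
        simp only [gaussSum, AddChar.mulShift_apply, MulChar.ringHomComp_apply, eq_intCast]
        exact Finset.sum_congr rfl fun x _ => by congr 2; ring
    rw [Finset.sum_congr rfl h1, ← Finset.sum_mul, Finset.sum_erase _ (by simp), h2]
    push_cast
    rw [pow_succ, ← hg]
    ring

/-- The number of points on a diagonal affine quadric over a finite field of odd characteristic. In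
`∑ b_i² / (4 l_i)` the terms with `l_i = 0` are zero by the convention on division by zero. -/
theorem card_diagonal_quadric {F : Type*} [Field F] [Fintype F] [DecidableEq F]
    {ι : Type*} [Fintype ι] [DecidableEq ι] (hF : ringChar F ≠ 2) (l b : ι → F) (c : F) :
    (Fintype.card F : ℤ) *
        (Finset.univ.filter fun z : ι → F => ∑ i, (l i * z i ^ 2 - b i * z i) = c).card =
      (Fintype.card F : ℤ) ^ Fintype.card ι +
        if ∀ i, l i = 0 → b i = 0 then
          (Fintype.card F : ℤ) ^ (Finset.univ.filter fun i => l i = 0).card *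
            gaussDeviation F (Finset.univ.filter fun i => l i ≠ 0).card
              (∏ i with l i ≠ 0, l i) (c + ∑ i, b i ^ 2 / (4 * l i))
        else 0 := by
  obtain ⟨ψ, hψ⟩ : ∃ ψ : AddChar F ℂ, ψ.IsPrimitive :=
    ⟨AddChar.FiniteField.primitiveChar_to_Complex F,
      AddChar.FiniteField.primitiveChar_to_Complex_isPrimitive F⟩
  have h1 : ∀ z : ι → F, ∑ y : F, ψ (y * (∑ i, (l i * z i ^ 2 - b i * z i) - c)) =
      if ∑ i, (l i * z i ^ 2 - b i * z i) = c then (Fintype.card F : ℂ) else 0 := by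
    intro z
    have := AddChar.sum_mulShift (∑ i, (l i * z i ^ 2 - b i * z i) - c) hψ
    simpa only [sub_eq_zero, Nat.cast_ite, Nat.cast_zero] using this
  have h2 : ∑ z : ι → F, ∑ y : F, ψ (y * (∑ i, (l i * z i ^ 2 - b i * z i) - c)) =
      Fintype.card F *
        (Finset.univ.filter fun z : ι → F => ∑ i, (l i * z i ^ 2 - b i * z i) = c).card := by
    simp only [h1]
    rw [← Finset.sum_filter, Finset.sum_const, nsmul_eq_mul, mul_comm]
  have h3 : ∀ y : F, ∑ z : ι → F, ψ (y * (∑ i, (l i * z i ^ 2 - b i * z i) - c)) =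
      ψ (-y * c) * ∑ z : ι → F, ψ (y * ∑ i, (l i * z i ^ 2 - b i * z i)) := by
    intro y
    rw [Finset.mul_sum]
    refine Finset.sum_congr rfl fun z _ => ?_
    rw [← AddChar.map_add_eq_mul]
    congr 1
    ring
  have h4 : (∑ y : F, ψ (-y * c) * ∑ z : ι → F, ψ (y * ∑ i, (l i * z i ^ 2 - b i * z i))) =
      (Fintype.card F : ℂ) ^ Fintype.card ι + ∑ y ∈ Finset.univ.erase (0 : F),
        ψ (-y * c) * ∑ z : ι → F, ψ (y * ∑ i, (l i * z i ^ 2 - b i * z i)) := by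
    rw [← Finset.add_sum_erase _ _ (Finset.mem_univ 0)]
    simp
  rw [Finset.sum_comm, Finset.sum_congr rfl fun y _ => h3 y, h4] at h2
  have h5 : (∑ y ∈ Finset.univ.erase (0 : F),
      ψ (-y * c) * ∑ z : ι → F, ψ (y * ∑ i, (l i * z i ^ 2 - b i * z i))) =
      if ∀ i, l i = 0 → b i = 0 then
          (Fintype.card F : ℂ) ^ (Finset.univ.filter fun i => l i = 0).card *
            gaussDeviation F (Finset.univ.filter fun i => l i ≠ 0).card
              (∏ i with l i ≠ 0, l i) (c + ∑ i, b i ^ 2 / (4 * l i))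
        else 0 := by
    rw [Finset.sum_congr rfl fun y hy => by
      rw [sum_addChar_diagonal hF hψ (Finset.ne_of_mem_erase hy)]]
    split_ifs with hb
    · rw [← sum_ne_zero_eq_gaussDeviation hF hψ, Finset.mul_sum]
      refine Finset.sum_congr rfl fun y _ => ?_
      rw [mul_add, AddChar.map_add_eq_mul]
      ring
    · simp
  rw [h5] at h2
  have h6 := h2.symm
  apply Int.cast_injective (α := ℂ)
  push_cast
  exact h6

/-! ### Diagonalization of a quadratic form -/

/-- A matrix congruence that diagonalizes `A = (F(v_i, v_j))` gives linear coordinates in which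
`f` is a diagonal form. -/
theorem exists_diagonal_coordinates {p : ℕ} [Fact p.Prime] (hp : p ≠ 2) {V : Type*}
    [AddCommGroup V] [Module (ZMod p) V] {m : ℕ} (f : QuadraticForm (ZMod p) V)
    (v : Module.Basis (Fin m) (ZMod p) V) {ε : ℤ} (h : IsMatrixSign (formMatrix f v) ε) :
    ∃ (e : (Fin m → ZMod p) ≃ₗ[ZMod p] V) (l : Fin m → ZMod p),
      (∀ z, f (e z) = ∑ i, l i * z i ^ 2) ∧
      (Finset.univ.filter fun i => l i ≠ 0).card = formRank f v ∧
      ε = quadraticChar (ZMod p) (∏ i with l i ≠ 0, l i) := by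
  obtain ⟨M, l, hM, hl, hε⟩ := h
  have h2 : (2 : ZMod p) ≠ 0 := Ring.two_ne_zero (by rwa [ZMod.ringChar_zmod_n])
  let _ : Invertible (2 : ZMod p) := invertibleOfNonzero h2
  let B : LinearMap.BilinForm (ZMod p) V := QuadraticMap.associated f
  have hB : ∀ x y, B x y = halfPolar f x y := by
    intro x y
    have h := LinearMap.congr_fun
      (LinearMap.congr_fun (QuadraticMap.two_nsmul_associated (ZMod p) f) x) y
    apply mul_left_cancel₀ h2
    rw [halfPolar, mul_inv_cancel_left₀ h2]
    simpa [B, QuadraticMap.polar, two_mul, two_nsmul] using h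
  have hA : formMatrix f v = LinearMap.BilinForm.toMatrix v B := by
    ext i j
    simp [formMatrix, LinearMap.BilinForm.toMatrix_apply, hB]
  have hMd := (Matrix.isUnit_iff_isUnit_det _).1 hM
  have hMtd : IsUnit M.transpose.det := by rwa [Matrix.det_transpose]
  refine ⟨(Matrix.toLinearEquiv' M.transpose
    (Matrix.invertibleOfIsUnitDet _ hMtd)).trans v.equivFun.symm, l, fun z => ?_, ?_, hε⟩
  · have h3 := LinearMap.BilinForm.dotProduct_toMatrix_mulVec v B (M.transpose.mulVec z)
      (M.transpose.mulVec z)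
    have h4 : ∀ x, f x = B x x := fun x => (QuadraticMap.associated_eq_self_apply _ f x).symm
    rw [h4]
    refine h3.symm.trans ?_
    rw [← hA, Matrix.mulVec_transpose, ← Matrix.dotProduct_mulVec, ← Matrix.mulVec_transpose,
      Matrix.mulVec_mulVec, Matrix.mulVec_mulVec, hl]
    simp only [dotProduct, Matrix.mulVec_diagonal]
    exact Finset.sum_congr rfl fun i _ => by ring
  · rw [formRank, ← Matrix.rank_mul_eq_left_of_isUnit_det _ (formMatrix f v) hMtd,
      ← Matrix.rank_mul_eq_right_of_isUnit_det M _ hMd, ← Matrix.mul_assoc, hl,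
      Matrix.rank_diagonal, Fintype.card_subtype]

/-! ### Trace functionals and zeros of a codeword -/

theorem card_fiber_mul_card {V W : Type*} [AddGroup V] [AddGroup W] [Fintype V] [Fintype W]
    [DecidableEq W] (T : V →+ W) (hT : Function.Surjective T) (a : W) :
    (Finset.univ.filter fun x => T x = a).card * Fintype.card W = Fintype.card V := by
  have h := Finset.card_eq_sum_card_fiberwise (s := (Finset.univ : Finset V)) (f := T)
    (t := Finset.univ) (fun _ _ => Finset.mem_univ _)
  rw [Finset.sum_congr rfl fun b _ => AddMonoidHom.card_fiber_eq_of_mem_range T (hT b) (hT a),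
    Finset.sum_const, smul_eq_mul, Finset.card_univ, Finset.card_univ, mul_comm] at h
  exact h.symm

theorem trace_mul_eq_zero {p : ℕ} [Fact p.Prime] {K : Type*} [Field K] [Finite K]
    [Algebra (ZMod p) K] {a : K} (h : ∀ y, Algebra.trace (ZMod p) K (a * y) = 0) : a = 0 :=
  (traceForm_nondegenerate (ZMod p) K).1 a fun y => by simpa [Algebra.traceForm_apply] using h y

/-- The functional `y ↦ Tr(a y)`. -/
def traceMul (p : ℕ) [Fact p.Prime] {K : Type*} [Field K] [Algebra (ZMod p) K] (a : K) :
    K →ₗ[ZMod p] ZMod p :=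
  Algebra.traceForm (ZMod p) K a

@[simp]
theorem traceMul_apply (p : ℕ) [Fact p.Prime] {K : Type*} [Field K] [Algebra (ZMod p) K]
    (a y : K) : traceMul p a y = Algebra.trace (ZMod p) K (a * y) := rfl

theorem traceMul_surjective {p : ℕ} [Fact p.Prime] {K : Type*} [Field K] [Finite K]
    [Algebra (ZMod p) K] {a : K} (ha : a ≠ 0) : Function.Surjective (traceMul p a) :=
  LinearMap.surjective fun h => ha (trace_mul_eq_zero fun y => LinearMap.congr_fun h y)

theorem traceMul_prod_surjective {p : ℕ} [Fact p.Prime] {K : Type*} [Field K] [Finite K]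
    [Algebra (ZMod p) K] {a b : K} (ha : a ≠ 0) (hb : ∀ c : ZMod p, b ≠ c • a) :
    Function.Surjective ((traceMul p a).prod (traceMul p b)) := by
  rw [← LinearMap.range_eq_top]
  by_contra hne
  obtain ⟨φ, hφ, hle⟩ := Submodule.exists_le_ker_of_lt_top _ (lt_top_iff_ne_top.2 hne)
  have h1 : ∀ s t, φ (s, t) = s * φ (1, 0) + t * φ (0, 1) := by
    intro s t
    rw [← smul_eq_mul, ← smul_eq_mul, ← map_smul, ← map_smul, ← map_add]
    simp
  have h2 : φ (1, 0) • a + φ (0, 1) • b = 0 := by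
    refine trace_mul_eq_zero (p := p) fun y => ?_
    have h3 := hle (LinearMap.mem_range_self _ y)
    rw [LinearMap.mem_ker, show (traceMul p a).prod (traceMul p b) y = (traceMul p a y, traceMul p b y)
      from rfl, h1] at h3
    rw [add_mul, smul_mul_assoc, smul_mul_assoc, map_add, map_smul, map_smul, smul_eq_mul,
      smul_eq_mul, mul_comm, mul_comm (φ (0, 1))]
    simpa using h3
  by_cases h01 : φ (0, 1) = 0
  · rw [h01, zero_smul, add_zero, smul_eq_zero, or_iff_left ha] at h2
    exact hφ (LinearMap.ext fun ⟨s, t⟩ => by rw [h1, h2, h01]; simp)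
  · refine hb (-((φ (0, 1))⁻¹ * φ (1, 0))) ?_
    have h4 : b = (φ (0, 1))⁻¹ • (φ (0, 1) • b) := by rw [smul_smul, inv_mul_cancel₀ h01, one_smul]
    rw [h4, eq_neg_of_add_eq_zero_right h2, smul_neg, smul_smul, neg_smul]

section Code

variable {p : ℕ} [Fact p.Prime] {K₁ K₂ : Type*} [Field K₁] [Field K₂] [Fintype K₁] [Fintype K₂]
  [Algebra (ZMod p) K₁] [Algebra (ZMod p) K₂]

open Classical in
/-- The zeros `z` of `f(x) + Tr(α y)`, the origin included, at which the codeword of `X` has a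
zero coordinate. -/
def zeroLocus (f : QuadraticForm (ZMod p) K₁) (α : K₂) (X : K₁ × K₂) : Finset (K₁ × K₂) :=
  Finset.univ.filter fun z => f z.1 + Algebra.trace (ZMod p) K₂ (α * z.2) = 0 ∧
    Algebra.trace (ZMod p) K₁ (X.1 * z.1) + Algebra.trace (ZMod p) K₂ (X.2 * z.2) = 0

/-- The zeros of a codeword, counted over the fibres of the projection to `K₁`. -/
theorem card_zeroLocus (f : QuadraticForm (ZMod p) K₁) (α : K₂) (X : K₁ × K₂) :
    (zeroLocus f α X).card = ∑ x : K₁, (Finset.univ.filter fun y : K₂ =>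
      Algebra.trace (ZMod p) K₂ (α * y) = - f x ∧
      Algebra.trace (ZMod p) K₂ (X.2 * y) = - Algebra.trace (ZMod p) K₁ (X.1 * x)).card := by
  classical
  rw [zeroLocus, Finset.card_filter, Fintype.sum_prod_type]
  refine Finset.sum_congr rfl fun x _ => ?_
  rw [Finset.card_filter]
  refine Finset.sum_congr rfl fun y _ => ?_
  simp only [eq_neg_iff_add_eq_zero, add_comm]

theorem card_zeroLocus_of_not_smul (f : QuadraticForm (ZMod p) K₁) {α : K₂} (hα : α ≠ 0)
    (u : K₁) {v : K₂} (hv : ∀ c : ZMod p, v ≠ c • α) :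
    (zeroLocus f α (u, v)).card * p ^ 2 = Fintype.card K₁ * Fintype.card K₂ := by
  have h : ∀ x : K₁, (Finset.univ.filter fun y : K₂ =>
      Algebra.trace (ZMod p) K₂ (α * y) = - f x ∧
      Algebra.trace (ZMod p) K₂ (v * y) = - Algebra.trace (ZMod p) K₁ (u * x)).card * p ^ 2 =
      Fintype.card K₂ := by
    intro x
    have h1 := card_fiber_mul_card ((traceMul p α).prod (traceMul p v)).toAddMonoidHom
      (traceMul_prod_surjective hα hv) (- f x, - Algebra.trace (ZMod p) K₁ (u * x))
    rw [Fintype.card_prod, ZMod.card, ← sq] at h1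
    simpa [Prod.ext_iff] using h1
  rw [card_zeroLocus, Finset.sum_mul, Finset.sum_congr rfl fun x _ => h x, Finset.sum_const,
    smul_eq_mul, Finset.card_univ]

theorem card_zeroLocus_smul (f : QuadraticForm (ZMod p) K₁) {α : K₂} (hα : α ≠ 0)
    (u : K₁) (c : ZMod p) :
    (zeroLocus f α (u, c • α)).card * p =
      (Finset.univ.filter fun x => c * f x = Algebra.trace (ZMod p) K₁ (u * x)).card *
        Fintype.card K₂ := by
  classical
  have h : ∀ x : K₁, (Finset.univ.filter fun y : K₂ =>
      Algebra.trace (ZMod p) K₂ (α * y) = - f x ∧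
      Algebra.trace (ZMod p) K₂ ((c • α) * y) = - Algebra.trace (ZMod p) K₁ (u * x)).card * p =
      if c * f x = Algebra.trace (ZMod p) K₁ (u * x) then Fintype.card K₂ else 0 := by
    intro x
    split_ifs with hx
    · have h1 : (Finset.univ.filter fun y : K₂ =>
          Algebra.trace (ZMod p) K₂ (α * y) = - f x).card * Fintype.card (ZMod p) =
          Fintype.card K₂ :=
        card_fiber_mul_card (traceMul p α).toAddMonoidHom (traceMul_surjective hα) (- f x)
      rw [ZMod.card] at h1
      rw [← h1]
      congr 2
      ext y
      simp only [Finset.mem_filter, Finset.mem_univ, true_and, smul_mul_assoc, map_smul,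
        smul_eq_mul]
      -- The second condition on `y` is `c` times the first.
      refine and_iff_left_of_imp fun hy => ?_
      rw [hy, ← hx, mul_neg]
    · rw [Finset.filter_eq_empty_iff.2, Finset.card_empty, zero_mul]
      rintro y - ⟨hy, hy'⟩
      rw [smul_mul_assoc, map_smul, hy, smul_eq_mul, mul_neg, neg_inj] at hy'
      exact hx hy'
  rw [card_zeroLocus, Finset.sum_mul, Finset.sum_congr rfl fun x _ => h x, ← Finset.sum_filter,
    Finset.sum_const, smul_eq_mul]

theorem card_zeroLocus_zero (f : QuadraticForm (ZMod p) K₁) {α : K₂} (hα : α ≠ 0) :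
    (zeroLocus f α 0).card * p = Fintype.card K₁ * Fintype.card K₂ := by
  have h := card_zeroLocus_smul f hα 0 0
  rw [zero_smul, ← Prod.zero_eq_mk] at h
  simpa [Finset.card_univ] using h

theorem zero_mem_zeroLocus (f : QuadraticForm (ZMod p) K₁) (α : K₂) (X : K₁ × K₂) :
    (0, 0) ∈ zeroLocus f α X := by
  simp [zeroLocus]

theorem definingSet_eq (f : QuadraticForm (ZMod p) K₁) (α : K₂) [DecidableEq (K₁ × K₂)] :
    definingSet f α = (zeroLocus f α 0).erase (0, 0) := by
  ext z
  simp [definingSet, zeroLocus]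

/-- Removing the origin from the defining set does not affect weights, since every word vanishes
there. -/
theorem hammingNorm_add_card_zeroLocus (f : QuadraticForm (ZMod p) K₁) (α : K₂) (X : K₁ × K₂) :
    hammingNorm (codewordMap (p := p) (definingSet f α) X) + (zeroLocus f α X).card =
      (zeroLocus f α 0).card := by
  classical
  have h1 : hammingNorm (codewordMap (p := p) (definingSet f α) X) =
      ((zeroLocus f α 0) \ zeroLocus f α X).card := by
    rw [hammingNorm, ← Finset.card_map (Function.Embedding.subtype _)]
    congr 1
    ext z
    simp only [Finset.mem_map, Finset.mem_filter, Finset.mem_univ, true_and,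
      Function.Embedding.coe_subtype, Subtype.exists, Finset.mem_sdiff]
    constructor
    · rintro ⟨z', hz', hne, rfl⟩
      have hD := hz'
      rw [definingSet_eq, Finset.mem_erase] at hD
      refine ⟨hD.2, fun h => hne ?_⟩
      exact (Finset.mem_filter.1 h).2.2
    · rintro ⟨hz, hz'⟩
      have hD : z ∈ definingSet f α := by
        rw [definingSet_eq, Finset.mem_erase]
        refine ⟨fun h0 => hz' ?_, hz⟩
        rw [h0]
        exact zero_mem_zeroLocus f α X
      refine ⟨z, hD, fun h => hz' ?_, rfl⟩
      exact Finset.mem_filter.2 ⟨Finset.mem_univ _, (Finset.mem_filter.1 hz).2.1, h⟩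
  have h2 : zeroLocus f α X ⊆ zeroLocus f α 0 := by
    intro z hz
    simp only [zeroLocus, Finset.mem_filter, Finset.mem_univ, true_and] at hz ⊢
    simpa using hz.1
  rw [h1, Finset.card_sdiff_add_card_eq_card h2]

end Code

/-! ### Weights of the codewords -/

theorem quadraticChar_prod_inv_four_mul {F : Type*} [Field F] [Fintype F] [DecidableEq F]
    {ι : Type*} [Fintype ι] (hF : ringChar F ≠ 2) {l : ι → F} (hl : ∀ i, l i ≠ 0) :
    quadraticChar F (∏ i, (4 * l i)⁻¹) = quadraticChar F (∏ i, l i) := by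
  have h2 : (2 : F) ≠ 0 := Ring.two_ne_zero hF
  rw [map_prod, map_prod]
  refine Finset.prod_congr rfl fun i _ => ?_
  have h1 : (4 * l i)⁻¹ = l i * ((2 * l i)⁻¹) ^ 2 := by
    have := hl i
    rw [show (4 : F) = 2 * 2 by norm_num]
    field_simp
  rw [h1, map_mul, quadraticChar_sq_one' (inv_ne_zero (mul_ne_zero h2 (hl i))), mul_one]

/-- The number of linear forms with given value of the dual quadratic form
`b ↦ ∑ b_i² / (4 l_i)`. Its discriminant agrees with that of `∑ l_i z_i²` up to squares, so both
forms represent every value equally often. -/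
theorem card_dual_quadric {F : Type*} [Field F] [Fintype F] [DecidableEq F]
    {ι : Type*} [Fintype ι] [DecidableEq ι] (hF : ringChar F ≠ 2) {l : ι → F}
    (hl : ∀ i, l i ≠ 0) (a : F) :
    (Fintype.card F : ℤ) *
        (Finset.univ.filter fun b : ι → F => ∑ i, b i ^ 2 / (4 * l i) = a).card =
      (Fintype.card F : ℤ) ^ Fintype.card ι +
        gaussDeviation F (Fintype.card ι) (∏ i, l i) a := by
  have h4 : (4 : F) ≠ 0 := by
    rw [show (4 : F) = 2 * 2 by norm_num]
    exact mul_ne_zero (Ring.two_ne_zero hF) (Ring.two_ne_zero hF)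
  have hl' : ∀ i, (4 * l i)⁻¹ ≠ 0 := fun i => inv_ne_zero (mul_ne_zero h4 (hl i))
  have h := card_diagonal_quadric hF (fun i => (4 * l i)⁻¹) (fun _ => 0) a
  have e1 : (Finset.univ.filter fun i => (4 * l i)⁻¹ = 0) = ∅ :=
    Finset.filter_eq_empty_iff.2 fun i _ => hl' i
  have e2 : (Finset.univ.filter fun i => (4 * l i)⁻¹ ≠ 0) = Finset.univ :=
    Finset.filter_eq_self.2 fun i _ => hl' i
  rw [if_pos fun _ _ => rfl, e1, e2, Finset.card_empty, pow_zero, one_mul, Finset.card_univ] at h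
  have e3 : (Finset.univ.filter fun b : ι → F => ∑ i, b i ^ 2 / (4 * l i) = a) =
      Finset.univ.filter fun z : ι → F => ∑ i, ((4 * l i)⁻¹ * z i ^ 2 - 0 * z i) = a := by
    ext z
    simp only [Finset.mem_filter, Finset.mem_univ, true_and, zero_mul, sub_zero, div_eq_inv_mul]
  rw [e3, h]
  congr 1
  simp only [gaussDeviation, quadraticChar_prod_inv_four_mul hF hl]
  simp

/-- In linear coordinates `e` on `K`, every linear form on `K` is `Tr(u ·)` for a unique `u`;
this is the map sending `u` to the coefficients of that form. -/
def traceCoords {p : ℕ} [Fact p.Prime] {K : Type*} [Field K] [Fintype K] [Algebra (ZMod p) K]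
    {m : ℕ} (e : (Fin m → ZMod p) ≃ₗ[ZMod p] K) : K ≃ₗ[ZMod p] (Fin m → ZMod p) :=
  LinearEquiv.ofInjectiveOfFinrankEq
    (LinearMap.pi fun i => (traceMul p (e (Pi.single i 1))))
    (by
      rw [← LinearMap.ker_eq_bot, LinearMap.ker_eq_bot']
      intro u hu
      refine trace_mul_eq_zero (p := p) fun y => ?_
      obtain ⟨z, rfl⟩ := e.surjective y
      have h : (traceMul p u).comp e.toLinearMap = 0 := by
        refine LinearMap.pi_ext' fun i => LinearMap.ext_ring ?_
        have := congrFun hu i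
        simpa [mul_comm] using this
      exact LinearMap.congr_fun h z)
    e.symm.finrank_eq

theorem trace_mul_eq_sum_traceCoords {p : ℕ} [Fact p.Prime] {K : Type*} [Field K] [Fintype K]
    [Algebra (ZMod p) K] {m : ℕ} (e : (Fin m → ZMod p) ≃ₗ[ZMod p] K) (u : K) (z : Fin m → ZMod p) :
    Algebra.trace (ZMod p) K (u * e z) = ∑ i, traceCoords e u i * z i := by
  have h : ∀ i, traceCoords e u i = traceMul p (e (Pi.single i 1)) u := fun i => rfl
  have h1 := LinearMap.pi_apply_eq_sum_univ ((traceMul p u).comp e.toLinearMap) z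
  rw [LinearMap.comp_apply] at h1
  refine h1.trans (Finset.sum_congr rfl fun i _ => ?_)
  rw [h, smul_eq_mul, mul_comm]
  congr 1
  simp only [LinearMap.comp_apply, traceMul_apply, LinearEquiv.coe_coe]
  rw [mul_comm]
  congr 3
  ext j
  simp [Pi.single_apply, eq_comm]

/-- Extension by zero of a vector indexed by the support of `l`. -/
def extendSupport {F ι : Type*} [Zero F] [DecidableEq F] (l : ι → F) (b : {i // l i ≠ 0} → F)
    (i : ι) : F :=
  if h : l i ≠ 0 then b ⟨i, h⟩ else 0

theorem extendSupport_of_eq_zero {F ι : Type*} [Zero F] [DecidableEq F] (l : ι → F)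
    (b : {i // l i ≠ 0} → F) (i : ι) (h : l i = 0) : extendSupport l b i = 0 :=
  dif_neg (not_not.2 h)

theorem extendSupport_injective {F ι : Type*} [Zero F] [DecidableEq F] (l : ι → F) :
    Function.Injective (extendSupport l) := by
  intro b b' h
  ext ⟨i, hi⟩
  simpa [extendSupport, hi] using congrFun h i

theorem extendSupport_restrict {F ι : Type*} [Zero F] [DecidableEq F] (l b : ι → F)
    (h : ∀ i, l i = 0 → b i = 0) : extendSupport l (fun i => b i) = b := by
  ext i
  by_cases hi : l i = 0
  · simp [extendSupport, hi, h i hi]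
  · simp [extendSupport, hi]

theorem sum_extendSupport {F ι : Type*} [Field F] [DecidableEq F] [Fintype ι] (l : ι → F)
    (b : {i // l i ≠ 0} → F) :
    ∑ i, extendSupport l b i ^ 2 / (4 * l i) = ∑ i, b i ^ 2 / (4 * l i) := by
  classical
  rw [← Finset.sum_filter_of_ne (p := fun i => l i ≠ 0),
    Finset.sum_subtype (p := fun i => l i ≠ 0) _ (by simp)]
  · refine Finset.sum_congr rfl fun i _ => ?_
    rw [extendSupport, dif_pos i.2]
  · intro i _ h h0
    exact h (by simp [h0])

section Weights

variable {p : ℕ} [Fact p.Prime] {K₁ K₂ : Type*} [Field K₁] [Field K₂] [Fintype K₁]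
  [Algebra (ZMod p) K₁] [Algebra (ZMod p) K₂] {s₁ s₂ : ℕ}

/-- The message `(u, v)` with `v = c α` for which the linear form `c⁻¹ Tr(u ·)` has coefficients `b`
on the support of `l` and `0` elsewhere, where `q = (c, b)`. For `c ≠ 0` these are the messages for
which `c⁻¹ Tr(u ·)` vanishes on the radical of `f`, and only for them can the number of solutions
of `c f(x) = Tr(u x)` differ from the average. -/
def exceptionalPair (e : (Fin s₁ → ZMod p) ≃ₗ[ZMod p] K₁) (l : Fin s₁ → ZMod p) (α : K₂)
    (q : ZMod p × ({i // l i ≠ 0} → ZMod p)) : K₁ × K₂ :=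
  (q.1 • (traceCoords e).symm (extendSupport l q.2), q.1 • α)

theorem exceptionalPair_injOn (e : (Fin s₁ → ZMod p) ≃ₗ[ZMod p] K₁) (l : Fin s₁ → ZMod p)
    {α : K₂} (hα : α ≠ 0) : Set.InjOn (exceptionalPair e l α) {q | q.1 ≠ 0} := by
  rintro ⟨c, b⟩ hc ⟨c', b'⟩ _ h
  rw [exceptionalPair, exceptionalPair, Prod.mk.injEq] at h
  have hcc : c = c' := smul_left_injective (ZMod p) hα h.2
  subst hcc
  have := extendSupport_injective l
    ((traceCoords e).symm.injective (smul_right_injective K₁ (show c ≠ 0 from hc) h.1))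
  exact Prod.ext rfl this

variable [Fintype K₂]

/-- The weight of a codeword for which the number of zeros on the hypersurface
`f(x) + Tr(α y) = 0` is `p^(s-2) (1 + ρ)`, that is, `1 + ρ` times the average. -/
def codeWeight (p s : ℕ) (ρ : ℚ) : ℚ := (p : ℚ) ^ (s - 2) * (p - 1 - ρ)

theorem hammingNorm_of_card_zeroLocus (hK₁ : Fintype.card K₁ = p ^ s₁)
    (hK₂ : Fintype.card K₂ = p ^ s₂) (hs : 2 ≤ s₁ + s₂) (f : QuadraticForm (ZMod p) K₁) {α : K₂}
    (hα : α ≠ 0) (X : K₁ × K₂) (ρ : ℚ)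
    (h : ((zeroLocus f α X).card : ℚ) * p ^ 2 = p ^ (s₁ + s₂) * (1 + ρ)) :
    (hammingNorm (codewordMap (p := p) (definingSet f α) X) : ℚ) = codeWeight p (s₁ + s₂) ρ := by
  have hp0 : (p : ℚ) ≠ 0 := by exact_mod_cast (Fact.out : p.Prime).ne_zero
  have h1 : (hammingNorm (codewordMap (p := p) (definingSet f α) X) : ℚ) +
      (zeroLocus f α X).card = (zeroLocus f α 0).card := by
    exact_mod_cast hammingNorm_add_card_zeroLocus f α X
  have h2 : ((zeroLocus f α 0).card : ℚ) * p = p ^ (s₁ + s₂) := by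
    have := card_zeroLocus_zero f hα
    rw [hK₁, hK₂, ← pow_add] at this
    exact_mod_cast this
  obtain ⟨k, hk⟩ := Nat.exists_eq_add_of_le hs
  rw [codeWeight, hk, Nat.add_sub_cancel_left]
  rw [hk, pow_add] at h h2
  apply mul_left_cancel₀ (pow_ne_zero 2 hp0)
  linear_combination (p : ℚ) ^ 2 * h1 - h + p * h2

theorem card_linear_quadric (f : QuadraticForm (ZMod p) K₁)
    (e : (Fin s₁ → ZMod p) ≃ₗ[ZMod p] K₁) (l : Fin s₁ → ZMod p)
    (hf : ∀ z, f (e z) = ∑ i, l i * z i ^ 2) {c : ZMod p} (hc : c ≠ 0) (b : Fin s₁ → ZMod p) :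
    (Finset.univ.filter fun x => c * f x =
        Algebra.trace (ZMod p) K₁ (c • (traceCoords e).symm b * x)).card =
      (Finset.univ.filter fun z : Fin s₁ → ZMod p =>
        ∑ i, (l i * z i ^ 2 - b i * z i) = 0).card := by
  symm
  refine Finset.card_equiv e.toEquiv fun z => ?_
  simp only [Finset.mem_filter, Finset.mem_univ, true_and, LinearEquiv.coe_toEquiv, hf,
    smul_mul_assoc, map_smul, smul_eq_mul, trace_mul_eq_sum_traceCoords,
    LinearEquiv.apply_symm_apply, mul_right_inj' hc, Finset.sum_sub_distrib, sub_eq_zero]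

theorem hammingNorm_exceptional (hp : p ≠ 2) (hK₁ : Fintype.card K₁ = p ^ s₁)
    (hK₂ : Fintype.card K₂ = p ^ s₂) (hs : 2 ≤ s₁ + s₂) (f : QuadraticForm (ZMod p) K₁) {α : K₂}
    (hα : α ≠ 0) (e : (Fin s₁ → ZMod p) ≃ₗ[ZMod p] K₁) (l : Fin s₁ → ZMod p)
    (hf : ∀ z, f (e z) = ∑ i, l i * z i ^ 2) {c : ZMod p} (hc : c ≠ 0)
    (b : {i // l i ≠ 0} → ZMod p) {R : ℕ} (hR : (Finset.univ.filter fun i => l i ≠ 0).card = R) :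
    (hammingNorm (codewordMap (p := p) (definingSet f α) (exceptionalPair e l α (c, b))) : ℚ) =
      codeWeight p (s₁ + s₂)
        (gaussDeviation (ZMod p) R (∏ i with l i ≠ 0, l i) (∑ i, b i ^ 2 / (4 * l i)) / p ^ R) := by
  have hp0 : (p : ℚ) ≠ 0 := by exact_mod_cast (Fact.out : p.Prime).ne_zero
  apply hammingNorm_of_card_zeroLocus hK₁ hK₂ hs f hα
  have h1 := card_zeroLocus_smul f hα (c • (traceCoords e).symm (extendSupport l b)) c
  rw [card_linear_quadric f e l hf hc, hK₂] at h1
  have h2 := card_diagonal_quadric (F := ZMod p) (by rwa [ZMod.ringChar_zmod_n]) l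
    (extendSupport l b) 0
  rw [if_pos (extendSupport_of_eq_zero l b), hR, zero_add, sum_extendSupport, ZMod.card,
    Fintype.card_fin] at h2
  have h3 : (Finset.univ.filter fun i => l i = 0).card + R = s₁ := by
    have := Finset.card_filter_add_card_filter_not (s := (Finset.univ : Finset (Fin s₁)))
      (fun i => l i = 0)
    rw [hR, Finset.card_univ, Fintype.card_fin] at this
    exact this
  have h1' := congrArg (Nat.cast : ℕ → ℚ) h1
  have h2' := congrArg (Int.cast : ℤ → ℚ) h2
  push_cast at h1' h2'
  rw [exceptionalPair, pow_add, mul_add, mul_one]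
  set δ : ℚ :=
    ((gaussDeviation (ZMod p) R (∏ i with l i ≠ 0, l i) (∑ i, b i ^ 2 / (4 * l i)) : ℤ) : ℚ)
  have h4 : (p : ℚ) ^ s₁ * (δ / p ^ R) =
      p ^ (Finset.univ.filter fun i => l i = 0).card * δ := by
    rw [← congrArg (fun k : ℕ => (p : ℚ) ^ k) h3, pow_add]
    field_simp
  linear_combination p * h1' + p ^ s₂ * h2' - p ^ s₂ * h4

/-- Every nonzero message that is not exceptional has the average weight. -/
theorem hammingNorm_generic (hp : p ≠ 2) (hK₁ : Fintype.card K₁ = p ^ s₁)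
    (hK₂ : Fintype.card K₂ = p ^ s₂) (hs : 2 ≤ s₁ + s₂) (f : QuadraticForm (ZMod p) K₁) {α : K₂}
    (hα : α ≠ 0) (e : (Fin s₁ → ZMod p) ≃ₗ[ZMod p] K₁) (l : Fin s₁ → ZMod p)
    (hf : ∀ z, f (e z) = ∑ i, l i * z i ^ 2) {X : K₁ × K₂} (hX : X ≠ 0)
    (h : ∀ c b, c ≠ 0 → exceptionalPair e l α (c, b) ≠ X) :
    (hammingNorm (codewordMap (p := p) (definingSet f α) X) : ℚ) =
      codeWeight p (s₁ + s₂) 0 := by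
  apply hammingNorm_of_card_zeroLocus hK₁ hK₂ hs f hα
  rw [add_zero, mul_one]
  obtain ⟨u, v⟩ := X
  by_cases hv : ∀ c : ZMod p, v ≠ c • α
  · have h1 := card_zeroLocus_of_not_smul f hα u hv
    rw [hK₁, hK₂, ← pow_add] at h1
    exact_mod_cast h1
  push Not at hv
  obtain ⟨c, rfl⟩ := hv
  have h1 := card_zeroLocus_smul f hα u c
  suffices h2 : (Finset.univ.filter fun x => c * f x =
      Algebra.trace (ZMod p) K₁ (u * x)).card * p = p ^ s₁ by
    have h3 : (zeroLocus f α (u, c • α)).card * p ^ 2 = p ^ (s₁ + s₂) := by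
      rw [sq, ← mul_assoc, h1, hK₂, mul_right_comm, h2, pow_add]
    exact_mod_cast h3
  by_cases hc : c = 0
  · subst hc
    have hu : u ≠ 0 := fun hu => hX (by rw [hu, zero_smul]; rfl)
    have h3 : (Finset.univ.filter fun x : K₁ =>
        Algebra.trace (ZMod p) K₁ (u * x) = 0).card * Fintype.card (ZMod p) = Fintype.card K₁ :=
      card_fiber_mul_card (traceMul p u).toAddMonoidHom (traceMul_surjective hu) 0
    rw [ZMod.card, hK₁] at h3
    rw [← h3]
    simp only [zero_mul, eq_comm]
  · set b := traceCoords e (c⁻¹ • u) with hb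
    have hu : u = c • (traceCoords e).symm b := by
      rw [hb, LinearEquiv.symm_apply_apply, smul_smul, mul_inv_cancel₀ hc, one_smul]
    have hsupp : ¬ ∀ i, l i = 0 → b i = 0 := by
      intro hs
      refine h c (fun i => b i) hc ?_
      rw [exceptionalPair, extendSupport_restrict l b hs, hu]
    have h2 := card_diagonal_quadric (F := ZMod p) (by rwa [ZMod.ringChar_zmod_n]) l b 0
    rw [if_neg hsupp, add_zero, ZMod.card, Fintype.card_fin, mul_comm] at h2
    rw [hu, card_linear_quadric f e l hf hc]
    exact_mod_cast h2

end Weights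

/-! ### Weight distributions from a partition of the messages -/

theorem weightCount_range {p : ℕ} {ι X : Type*} [Fintype ι] [AddCommGroup X]
    [Module (ZMod p) X] [Fintype X] (g : X →ₗ[ZMod p] (ι → ZMod p)) (hg : Function.Injective g)
    (i : ℕ) : weightCount (LinearMap.range g) i =
      (Finset.univ.filter fun x => hammingNorm (g x) = i).card := by
  rw [weightCount, ← Fintype.card_subtype, ← Nat.card_eq_fintype_card]
  refine (Nat.card_congr ?_).symm
  exact (LinearEquiv.ofInjective g hg).toEquiv.subtypeEquiv fun x => by simp

theorem isTWeightCode_three {p : ℕ} {ι : Type*} [Fintype ι]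
    {C : Submodule (ZMod p) (ι → ZMod p)} {n₀ W₁ W₂ W₃ n₁ n₂ n₃ : ℚ}
    (h : HasWeightTable C [(0, n₀), (W₁, n₁), (W₂, n₂), (W₃, n₃)])
    (hn₁ : n₁ ≠ 0) (hn₂ : n₂ ≠ 0) (hn₃ : n₃ ≠ 0)
    (hW₁ : W₁ ≠ 0) (hW₂ : W₂ ≠ 0) (hW₃ : W₃ ≠ 0)
    (h₁₂ : W₁ ≠ W₂) (h₁₃ : W₁ ≠ W₃) (h₂₃ : W₂ ≠ W₃) : IsTWeightCode C 3 := by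
  obtain ⟨i₁, e₁, c₁⟩ := h.1 (W₁, n₁) (by simp)
  obtain ⟨i₂, e₂, c₂⟩ := h.1 (W₂, n₂) (by simp)
  obtain ⟨i₃, e₃, c₃⟩ := h.1 (W₃, n₃) (by simp)
  dsimp only at e₁ e₂ e₃ c₁ c₂ c₃
  subst e₁ e₂ e₃ c₁ c₂ c₃
  norm_cast at hn₁ hn₂ hn₃ hW₁ hW₂ hW₃ h₁₂ h₁₃ h₂₃
  have hset : {i : ℕ | i ≠ 0 ∧ weightCount C i ≠ 0} = {i₁, i₂, i₃} := by
    ext i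
    simp only [Set.mem_ofPred_eq, Set.mem_insert_iff, Set.mem_singleton_iff]
    constructor
    · rintro ⟨hi, hc⟩
      obtain ⟨r, hr, hri⟩ := h.2 i hc
      simp only [List.mem_cons, List.not_mem_nil, or_false] at hr
      rcases hr with rfl | rfl | rfl | rfl <;> dsimp only at hri
      · exact absurd (by exact_mod_cast hri.symm) hi
      · exact Or.inl (by exact_mod_cast hri.symm)
      · exact Or.inr (Or.inl (by exact_mod_cast hri.symm))
      · exact Or.inr (Or.inr (by exact_mod_cast hri.symm))
    · rintro (rfl | rfl | rfl)
      exacts [⟨hW₁, hn₁⟩, ⟨hW₂, hn₂⟩, ⟨hW₃, hn₃⟩]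
  rw [IsTWeightCode, hset, Set.ncard_eq_three]
  exact ⟨i₁, i₂, i₃, h₁₂, h₁₃, h₂₃, rfl⟩

/-- The weight distribution of an injective encoding whose nonzero messages have weight `i₂` on
`S₂`, `i₃` on `S₃` and `i₁` elsewhere. -/
theorem hasWeightTable_of_partition {p : ℕ} {ι X : Type*} [Fintype ι] [AddCommGroup X]
    [Module (ZMod p) X] [Fintype X] (g : X →ₗ[ZMod p] (ι → ZMod p)) (hg : Function.Injective g)
    (S₂ S₃ : Finset X) {i₁ i₂ i₃ : ℕ} (hi₁ : i₁ ≠ 0) (hi₂ : i₂ ≠ 0) (hi₃ : i₃ ≠ 0)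
    (h₁₂ : i₁ ≠ i₂) (h₁₃ : i₁ ≠ i₃) (h₂₃ : i₂ ≠ i₃)
    (hS₂ : ∀ x ∈ S₂, hammingNorm (g x) = i₂) (hS₃ : ∀ x ∈ S₃, hammingNorm (g x) = i₃)
    (h : ∀ x, x ≠ 0 → x ∉ S₂ → x ∉ S₃ → hammingNorm (g x) = i₁) :
    HasWeightTable (LinearMap.range g) [(0, 1),
      ((i₁ : ℚ), (Fintype.card X : ℚ) - S₂.card - S₃.card - 1),
      ((i₂ : ℚ), (S₂.card : ℚ)), ((i₃ : ℚ), (S₃.card : ℚ))] := by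
  classical
  have h0 : hammingNorm (g 0) = 0 := by simp
  have key : ∀ x, (x = 0 ∧ hammingNorm (g x) = 0 ∧ x ∉ S₂ ∧ x ∉ S₃) ∨
      (x ≠ 0 ∧ hammingNorm (g x) = i₁ ∧ x ∉ S₂ ∧ x ∉ S₃) ∨
      (x ≠ 0 ∧ hammingNorm (g x) = i₂ ∧ x ∈ S₂ ∧ x ∉ S₃) ∨
      (x ≠ 0 ∧ hammingNorm (g x) = i₃ ∧ x ∉ S₂ ∧ x ∈ S₃) := by
    intro x
    have a2 := hS₂ x
    have a3 := hS₃ x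
    have a1 := h x
    by_cases hx : x = 0
    · rw [← hx] at h0
      grind
    · grind
  have c0 : (Finset.univ.filter fun x => hammingNorm (g x) = 0) = {0} := by
    ext x
    have := key x
    simp only [Finset.mem_filter, Finset.mem_univ, true_and, Finset.mem_singleton]
    grind
  have c2 : (Finset.univ.filter fun x => hammingNorm (g x) = i₂) = S₂ := by
    ext x
    have := key x
    simp only [Finset.mem_filter, Finset.mem_univ, true_and]
    grind
  have c3 : (Finset.univ.filter fun x => hammingNorm (g x) = i₃) = S₃ := by
    ext x
    have := key x
    simp only [Finset.mem_filter, Finset.mem_univ, true_and]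
    grind
  have c1 : (Finset.univ.filter fun x => hammingNorm (g x) = i₁).card + S₂.card + S₃.card + 1 =
      Fintype.card X := by
    rw [← Finset.card_univ, ← Finset.card_singleton (0 : X), ← Finset.card_union_of_disjoint,
      ← Finset.card_union_of_disjoint, ← Finset.card_union_of_disjoint]
    · congr 1
      ext x
      have := key x
      simp only [Finset.mem_union, Finset.mem_filter, Finset.mem_univ, true_and,
        Finset.mem_singleton]
      grind
    all_goals
      rw [Finset.disjoint_left]
      intro x
      have := key x
      simp only [Finset.mem_union, Finset.mem_filter, Finset.mem_univ, true_and,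
        Finset.mem_singleton]
      grind
  refine ⟨?_, fun i hi => ?_⟩
  · simp only [List.forall_mem_cons, List.not_mem_nil, false_implies, implies_true, and_true]
    refine ⟨⟨0, by simp, ?_⟩, ⟨i₁, rfl, ?_⟩, ⟨i₂, rfl, ?_⟩, ⟨i₃, rfl, ?_⟩⟩
    · rw [weightCount_range g hg, c0]
      simp
    · rw [weightCount_range g hg, ← c1]
      push_cast
      ring
    · rw [weightCount_range g hg, c2]
    · rw [weightCount_range g hg, c3]
  · rw [weightCount_range g hg, Finset.card_ne_zero] at hi
    obtain ⟨x, hx⟩ := hi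
    rw [Finset.mem_filter] at hx
    rw [← hx.2]
    rcases key x with h' | h' | h' | h' <;> rw [h'.2.1] <;> simp

section Table

variable {p : ℕ} [Fact p.Prime] {K₁ K₂ : Type*} [Field K₁] [Field K₂] [Fintype K₁]
  [Algebra (ZMod p) K₁] [Algebra (ZMod p) K₂] {s₁ s₂ : ℕ}

open Classical in
/-- The exceptional messages for which the value `∑ b_i² / (4 l_i)` of the dual form lies in `A`. -/
def exceptionalSet (e : (Fin s₁ → ZMod p) ≃ₗ[ZMod p] K₁) (l : Fin s₁ → ZMod p) (α : K₂)
    (A : Finset (ZMod p)) : Finset (K₁ × K₂) :=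
  ((Finset.univ.erase (0 : ZMod p)) ×ˢ
    Finset.univ.filter fun b : {i // l i ≠ 0} → ZMod p =>
      ∑ i, b i ^ 2 / (4 * l i) ∈ A).image (exceptionalPair e l α)

theorem card_exceptionalSet (hp : p ≠ 2) (e : (Fin s₁ → ZMod p) ≃ₗ[ZMod p] K₁)
    (l : Fin s₁ → ZMod p) {α : K₂} (hα : α ≠ 0) {R : ℕ}
    (hR : (Finset.univ.filter fun i => l i ≠ 0).card = R) (hR1 : 1 ≤ R)
    (A : Finset (ZMod p)) (ρ : ℚ)
    (hA : ∀ a ∈ A, (gaussDeviation (ZMod p) R (∏ i with l i ≠ 0, l i) a : ℚ) = p ^ R * ρ) :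
    ((exceptionalSet e l α A).card : ℚ) = (p - 1) * A.card * p ^ (R - 1) * (1 + ρ) := by
  classical
  have hp0 : (p : ℚ) ≠ 0 := by exact_mod_cast (Fact.out : p.Prime).ne_zero
  have hp1 : 1 ≤ p := (Fact.out : p.Prime).one_lt.le
  have hfib := Finset.card_eq_sum_card_fiberwise (t := A)
    (s := Finset.univ.filter fun b : {i // l i ≠ 0} → ZMod p => ∑ i, b i ^ 2 / (4 * l i) ∈ A)
    (f := fun b : {i // l i ≠ 0} → ZMod p => ∑ i, b i ^ 2 / (4 * l i))
    (fun b hb => by simpa using hb)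
  rw [exceptionalSet, Finset.card_image_of_injOn, Finset.card_product,
    Finset.card_erase_of_mem (Finset.mem_univ _), Finset.card_univ, ZMod.card, hfib]
  · rw [Nat.cast_mul, Nat.cast_sub hp1, Nat.cast_one, Nat.cast_sum, mul_assoc, mul_assoc]
    congr 1
    rw [← nsmul_eq_mul]
    refine Finset.sum_eq_card_nsmul fun a ha => ?_
    have h1 := card_dual_quadric (F := ZMod p) (by rwa [ZMod.ringChar_zmod_n])
      (l := fun i : {i // l i ≠ 0} => l i) (fun i => i.2) a
    have h2 : ∏ i : {i // l i ≠ 0}, l i = ∏ i with l i ≠ 0, l i :=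
      (Finset.prod_subtype _ (by simp) _).symm
    rw [h2, Fintype.card_subtype, hR, ZMod.card] at h1
    have h3 : (Finset.univ.filter fun b : {i // l i ≠ 0} → ZMod p =>
          ∑ i, b i ^ 2 / (4 * l i) ∈ A).filter (fun b : {i // l i ≠ 0} → ZMod p =>
            ∑ i, b i ^ 2 / (4 * l i) = a) =
        Finset.univ.filter fun b : {i // l i ≠ 0} → ZMod p => ∑ i, b i ^ 2 / (4 * l i) = a := by
      ext b
      simp only [Finset.mem_filter, Finset.mem_univ, true_and, and_iff_right_iff_imp]
      rintro rfl
      exact ha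
    rw [h3]
    have h4 := congrArg (Int.cast : ℤ → ℚ) h1
    push_cast at h4
    rw [hA a ha] at h4
    apply mul_left_cancel₀ hp0
    rw [h4]
    obtain ⟨k, rfl⟩ := Nat.exists_eq_add_of_le' hR1
    rw [Nat.add_sub_cancel, pow_succ]
    ring
  · refine (exceptionalPair_injOn e l hα).mono fun q hq => ?_
    rw [Finset.mem_coe, Finset.mem_product] at hq
    exact Finset.ne_of_mem_erase hq.1

variable [Fintype K₂]

/-- The weight distribution of the code, from the values `ρ₂`, `ρ₃` and `0` of the normalized
deviation: the nonzero ones are taken on `A₂` and `A₃`. That the weights are natural numbers is a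
hypothesis because a class of messages may be empty, as happens for rank `1`. -/
theorem hasWeightTable_definingCode (hp : p ≠ 2) (hK₁ : Fintype.card K₁ = p ^ s₁)
    (hK₂ : Fintype.card K₂ = p ^ s₂) (hs : 2 ≤ s₁ + s₂) (f : QuadraticForm (ZMod p) K₁) {α : K₂}
    (hα : α ≠ 0) (e : (Fin s₁ → ZMod p) ≃ₗ[ZMod p] K₁) (l : Fin s₁ → ZMod p)
    (hf : ∀ z, f (e z) = ∑ i, l i * z i ^ 2) {R : ℕ}
    (hR : (Finset.univ.filter fun i => l i ≠ 0).card = R) (hR1 : 1 ≤ R)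
    (A₂ A₃ : Finset (ZMod p)) (ρ₂ ρ₃ : ℚ)
    (hA₂ : ∀ a ∈ A₂, (gaussDeviation (ZMod p) R (∏ i with l i ≠ 0, l i) a : ℚ) = p ^ R * ρ₂)
    (hA₃ : ∀ a ∈ A₃, (gaussDeviation (ZMod p) R (∏ i with l i ≠ 0, l i) a : ℚ) = p ^ R * ρ₃)
    (hA : ∀ a, a ∉ A₂ → a ∉ A₃ → gaussDeviation (ZMod p) R (∏ i with l i ≠ 0, l i) a = 0)
    (hρ₂ : ρ₂ ≠ 0) (hρ₃ : ρ₃ ≠ 0) (hρ : ρ₂ ≠ ρ₃) (hlt₂ : ρ₂ < p - 1) (hlt₃ : ρ₃ < p - 1)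
    (hnat₂ : ∃ i : ℕ, (i : ℚ) = codeWeight p (s₁ + s₂) ρ₂)
    (hnat₃ : ∃ i : ℕ, (i : ℚ) = codeWeight p (s₁ + s₂) ρ₃) :
    let n : ℚ → Finset (ZMod p) → ℚ := fun ρ A => (p - 1) * A.card * p ^ (R - 1) * (1 + ρ)
    let C := definingCode (p := p) (definingSet f α)
    HasWeightTable C [(0, 1),
        (codeWeight p (s₁ + s₂) 0, p ^ (s₁ + s₂) - n ρ₂ A₂ - n ρ₃ A₃ - 1),
        (codeWeight p (s₁ + s₂) ρ₂, n ρ₂ A₂), (codeWeight p (s₁ + s₂) ρ₃, n ρ₃ A₃)] ∧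
      Module.finrank (ZMod p) C = s₁ + s₂ ∧
      (p ^ (s₁ + s₂) - n ρ₂ A₂ - n ρ₃ A₃ - 1 ≠ 0 → n ρ₂ A₂ ≠ 0 → n ρ₃ A₃ ≠ 0 →
        IsTWeightCode C 3) := by
  classical
  intro n C
  have hp0 : (0 : ℚ) < p := by exact_mod_cast (Fact.out : p.Prime).pos
  have hp1 : (1 : ℚ) < p := by exact_mod_cast (Fact.out : p.Prime).one_lt
  have hW : ∀ ρ ρ', codeWeight p (s₁ + s₂) ρ = codeWeight p (s₁ + s₂) ρ' → ρ = ρ' := by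
    intro ρ ρ' h
    have := mul_left_cancel₀ (pow_ne_zero _ hp0.ne') h
    linarith
  have hpos : ∀ ρ : ℚ, ρ < p - 1 → codeWeight p (s₁ + s₂) ρ ≠ 0 := fun ρ h =>
    (mul_pos (pow_pos hp0 _) (by linarith)).ne'
  obtain ⟨i₂, hi₂⟩ := hnat₂
  obtain ⟨i₃, hi₃⟩ := hnat₃
  obtain ⟨i₁, hi₁⟩ : ∃ i : ℕ, (i : ℚ) = codeWeight p (s₁ + s₂) 0 :=
    ⟨p ^ (s₁ + s₂ - 2) * (p - 1), by
      rw [codeWeight, Nat.cast_mul, Nat.cast_pow, Nat.cast_sub (Fact.out : p.Prime).one_lt.le]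
      simp⟩
  set g := codewordMap (p := p) (definingSet f α) with hg
  have hS : ∀ (A : Finset (ZMod p)) (ρ : ℚ),
      (∀ a ∈ A, (gaussDeviation (ZMod p) R (∏ i with l i ≠ 0, l i) a : ℚ) = p ^ R * ρ) →
      ∀ x ∈ exceptionalSet e l α A, (hammingNorm (g x) : ℚ) = codeWeight p (s₁ + s₂) ρ := by
    intro A ρ hA x hx
    rw [exceptionalSet, Finset.mem_image] at hx
    obtain ⟨⟨c, b⟩, hcb, rfl⟩ := hx
    rw [Finset.mem_product] at hcb
    rw [hg, hammingNorm_exceptional hp hK₁ hK₂ hs f hα e l hf (Finset.ne_of_mem_erase hcb.1) b hR,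
      hA _ (Finset.mem_filter.1 hcb.2).2, mul_div_cancel_left₀ _ (pow_ne_zero _ hp0.ne')]
  have hS₁ : ∀ x, x ≠ 0 → x ∉ exceptionalSet e l α A₂ → x ∉ exceptionalSet e l α A₃ →
      (hammingNorm (g x) : ℚ) = codeWeight p (s₁ + s₂) 0 := by
    intro x hx h₂ h₃
    by_cases h : ∀ c b, c ≠ 0 → exceptionalPair e l α (c, b) ≠ x
    · exact hammingNorm_generic hp hK₁ hK₂ hs f hα e l hf hx h
    · push Not at h
      obtain ⟨c, b, hc, rfl⟩ := h
      have hmem : ∀ A : Finset (ZMod p), exceptionalPair e l α (c, b) ∉ exceptionalSet e l α A →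
          ∑ i, b i ^ 2 / (4 * l i) ∉ A := by
        intro A h hA
        refine h (Finset.mem_image_of_mem _ ?_)
        simp [hc, hA]
      rw [hg, hammingNorm_exceptional hp hK₁ hK₂ hs f hα e l hf hc b hR,
        hA _ (hmem _ h₂) (hmem _ h₃), Int.cast_zero, zero_div]
  have hginj : Function.Injective g := by
    rw [← LinearMap.ker_eq_bot, LinearMap.ker_eq_bot']
    intro x hx
    by_contra hx0
    have h0 : (hammingNorm (g x) : ℚ) = 0 := by rw [hx]; simp
    by_cases h₂ : x ∈ exceptionalSet e l α A₂
    · exact hpos _ hlt₂ ((hS A₂ ρ₂ hA₂ x h₂).symm.trans h0)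
    by_cases h₃ : x ∈ exceptionalSet e l α A₃
    · exact hpos _ hlt₃ ((hS A₃ ρ₃ hA₃ x h₃).symm.trans h0)
    exact hpos 0 (by linarith) ((hS₁ x hx0 h₂ h₃).symm.trans h0)
  have hcard : Fintype.card (K₁ × K₂) = p ^ (s₁ + s₂) := by
    rw [Fintype.card_prod, hK₁, hK₂, pow_add]
  have hne : ∀ {i j : ℕ} {ρ ρ' : ℚ}, (i : ℚ) = codeWeight p (s₁ + s₂) ρ →
      (j : ℚ) = codeWeight p (s₁ + s₂) ρ' → ρ ≠ ρ' → i ≠ j := by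
    intro i j ρ ρ' h h' hρ hij
    exact hρ (hW _ _ (by rw [← h, ← h', hij]))
  have hne0 : ∀ {i : ℕ} {ρ : ℚ}, (i : ℚ) = codeWeight p (s₁ + s₂) ρ → ρ < p - 1 → i ≠ 0 := by
    intro i ρ h hρ hi
    exact hpos ρ hρ (by rw [← h, hi, Nat.cast_zero])
  have htable := hasWeightTable_of_partition g hginj (exceptionalSet e l α A₂)
    (exceptionalSet e l α A₃) (hne0 hi₁ (by linarith)) (hne0 hi₂ hlt₂) (hne0 hi₃ hlt₃)
    (hne hi₁ hi₂ hρ₂.symm) (hne hi₁ hi₃ hρ₃.symm) (hne hi₂ hi₃ hρ)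
    (fun x hx => by exact_mod_cast (hS A₂ ρ₂ hA₂ x hx).trans hi₂.symm)
    (fun x hx => by exact_mod_cast (hS A₃ ρ₃ hA₃ x hx).trans hi₃.symm)
    (fun x hx h₂ h₃ => by exact_mod_cast (hS₁ x hx h₂ h₃).trans hi₁.symm)
  rw [card_exceptionalSet hp e l hα hR hR1 A₂ ρ₂ hA₂,
    card_exceptionalSet hp e l hα hR hR1 A₃ ρ₃ hA₃, hcard, hi₁, hi₂, hi₃, Nat.cast_pow] at htable
  refine ⟨htable, ?_, fun h₁ h₂ h₃ => ?_⟩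
  · have h1 := LinearMap.finrank_range_of_inj hginj
    have h2 := Module.card_eq_pow_finrank (K := ZMod p) (V := K₁ × K₂)
    rw [hcard, ZMod.card] at h2
    exact h1.trans (Nat.pow_right_injective (Fact.out : p.Prime).two_le h2).symm
  · exact isTWeightCode_three htable h₁ h₂ h₃ (hpos 0 (by linarith)) (hpos _ hlt₂) (hpos _ hlt₃)
      (fun h => hρ₂ (hW _ _ h).symm) (fun h => hρ₃ (hW _ _ h).symm) (fun h => hρ (hW _ _ h))

end Table

/-! ### Evaluation of the deviations -/

theorem quadraticChar_neg_one_mul_eq_pStar {p : ℕ} [Fact p.Prime] (hp : p ≠ 2) :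
    ((quadraticChar (ZMod p) (-1) : ℤ) : ℚ) * p = pStar p := by
  have h := quadraticChar_neg_one (F := ZMod p) (by rwa [ZMod.ringChar_zmod_n])
  have hodd : p % 2 = 1 := Nat.odd_iff.1 ((Fact.out : p.Prime).odd_of_ne_two hp)
  rw [h, ZMod.card, ZMod.χ₄_eq_neg_one_pow hodd, pStar, show p / 2 = (p - 1) / 2 by omega]
  push_cast
  rfl

theorem exists_nat_eq_codeWeight {p s k : ℕ} (hp : 0 < p) (hk : k ≤ s - 2) (j : ℤ)
    (h : (j : ℚ) / p ^ k < p - 1) : ∃ i : ℕ, (i : ℚ) = codeWeight p s (j / p ^ k) := by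
  have hp0 : (0 : ℚ) < p := by exact_mod_cast hp
  obtain ⟨n, hn⟩ := Nat.exists_eq_add_of_le hk
  have h1 : (((p : ℤ) ^ n * ((p - 1) * p ^ k - j) : ℤ) : ℚ) = codeWeight p s (j / p ^ k) := by
    rw [codeWeight, hn, pow_add]
    push_cast
    field_simp
  have h2 : 0 ≤ (p : ℤ) ^ n * ((p - 1) * p ^ k - j) := by
    have : (0 : ℚ) ≤ (((p : ℤ) ^ n * ((p - 1) * p ^ k - j) : ℤ) : ℚ) := by
      rw [h1]
      exact mul_nonneg (pow_nonneg hp0.le _) (by linarith)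
    exact_mod_cast this
  obtain ⟨i, hi⟩ := Int.eq_ofNat_of_zero_le h2
  exact ⟨i, by rw [← h1, hi]; simp⟩

/-- Each of the two classes of nonzero elements, squares and nonsquares, has `(p - 1) / 2`
elements. -/
theorem card_quadraticChar_eq {p : ℕ} [Fact p.Prime] (hp : p ≠ 2) {τ : ℤ} (hτ : τ = 1 ∨ τ = -1) :
    ((Finset.univ.filter fun a : ZMod p => τ * quadraticChar (ZMod p) a = 1).card : ℚ) =
      (p - 1) / 2 ∧
    ((Finset.univ.filter fun a : ZMod p => τ * quadraticChar (ZMod p) a = -1).card : ℚ) =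
      (p - 1) / 2 := by
  have hF : ringChar (ZMod p) ≠ 2 := by rwa [ZMod.ringChar_zmod_n]
  have h1 : ((Finset.univ.filter fun a : ZMod p => τ * quadraticChar (ZMod p) a = 1).card : ℤ) -
      (Finset.univ.filter fun a : ZMod p => τ * quadraticChar (ZMod p) a = -1).card = 0 := by
    rw [← mul_zero τ, ← quadraticChar_sum_zero hF, Finset.mul_sum, Finset.card_filter,
      Finset.card_filter]
    push_cast
    rw [← Finset.sum_sub_distrib]
    refine Finset.sum_congr rfl fun a _ => ?_
    rcases hτ with rfl | rfl <;>
    rcases quadraticChar_isQuadratic (ZMod p) a with h | h | h <;> rw [h] <;> norm_num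
  have h2 : ((Finset.univ.filter fun a : ZMod p => τ * quadraticChar (ZMod p) a = 1).card : ℤ) +
      (Finset.univ.filter fun a : ZMod p => τ * quadraticChar (ZMod p) a = -1).card = p - 1 := by
    have h3 : ((Finset.univ.erase (0 : ZMod p)).card : ℤ) = p - 1 := by
      rw [Finset.card_erase_of_mem (Finset.mem_univ _), Finset.card_univ, ZMod.card,
        Nat.cast_sub (Fact.out : p.Prime).one_lt.le, Nat.cast_one]
    rw [← h3, Finset.card_filter, Finset.card_filter, ← Finset.filter_ne', Finset.card_filter]
    push_cast
    rw [← Finset.sum_add_distrib]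
    refine Finset.sum_congr rfl fun a _ => ?_
    by_cases ha : a = 0
    · simp [ha]
    · rw [if_pos ha]
      rcases hτ with rfl | rfl <;>
      rcases quadraticChar_dichotomy ha with h | h <;> rw [h] <;> norm_num
  have h1' := congrArg (Int.cast : ℤ → ℚ) h1
  have h2' := congrArg (Int.cast : ℤ → ℚ) h2
  push_cast at h1' h2'
  constructor <;> linarith

section Evaluation

variable {p : ℕ} [Fact p.Prime] {K₁ K₂ : Type*} [Field K₁] [Field K₂] [Fintype K₁] [Fintype K₂]
  [Algebra (ZMod p) K₁] [Algebra (ZMod p) K₂] {s₁ s₂ : ℕ}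

theorem weights_of_odd_rank (hp : p ≠ 2) (hK₁ : Fintype.card K₁ = p ^ s₁)
    (hK₂ : Fintype.card K₂ = p ^ s₂) (hs₂ : 1 ≤ s₂) (f : QuadraticForm (ZMod p) K₁) {α : K₂}
    (hα : α ≠ 0) (e : (Fin s₁ → ZMod p) ≃ₗ[ZMod p] K₁) (l : Fin s₁ → ZMod p)
    (hf : ∀ z, f (e z) = ∑ i, l i * z i ^ 2) {R : ℕ}
    (hR : (Finset.univ.filter fun i => l i ≠ 0).card = R) (hRodd : Odd R) :
    HasWeightTable (definingCode (p := p) (definingSet f α)) (oddTable p (s₁ + s₂) R) ∧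
      Module.finrank (ZMod p) (definingCode (p := p) (definingSet f α)) = s₁ + s₂ ∧
      (2 ≤ R → IsTWeightCode (definingCode (p := p) (definingSet f α)) 3) := by
  have hp3 : (3 : ℚ) ≤ p := by
    have := (Fact.out : p.Prime).two_le
    exact_mod_cast (by omega : 3 ≤ p)
  have hp0 : (0 : ℚ) < p := by linarith
  have hR1 : 1 ≤ R := hRodd.pos
  have hRs : R ≤ s₁ := by
    rw [← hR]
    simpa using Finset.card_filter_le (Finset.univ : Finset (Fin s₁)) (fun i => l i ≠ 0)
  obtain ⟨k, rfl⟩ := hRodd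
  set d := ∏ i with l i ≠ 0, l i with hd
  have hd0 : d ≠ 0 := Finset.prod_ne_zero_iff.2 fun i hi => (Finset.mem_filter.1 hi).2
  -- The exponent `k + 2` collects `η(-1)^(k+1)` from the Gauss sums and `η(-1)` from `η(-a)`.
  set τ : ℤ := quadraticChar (ZMod p) d * quadraticChar (ZMod p) (-1) ^ (k + 2) with hτdef
  have hτ : τ = 1 ∨ τ = -1 := by
    rw [hτdef, ← map_pow, ← map_mul]
    exact quadraticChar_dichotomy
      (mul_ne_zero hd0 (pow_ne_zero _ (neg_ne_zero.2 one_ne_zero)))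
  have hdev : ∀ a, gaussDeviation (ZMod p) (2 * k + 1) d a =
      p ^ (k + 1) * (τ * quadraticChar (ZMod p) a) := by
    intro a
    rw [gaussDeviation, if_neg (by simp [parity_simps]), hτdef, ZMod.card,
      show (2 * k + 1 + 1) / 2 = k + 1 by omega, neg_eq_neg_one_mul a, map_mul]
    ring
  have hA : ∀ (j : ℤ) (a), τ * quadraticChar (ZMod p) a = j →
      (gaussDeviation (ZMod p) (2 * k + 1) d a : ℚ) = p ^ (2 * k + 1) * (j / p ^ k) := by
    intro j a h
    rw [hdev, h]
    push_cast
    field_simp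
    ring
  obtain ⟨c₂, c₃⟩ := card_quadraticChar_eq hp hτ
  have ht0 : (0 : ℚ) < 1 / p ^ k := by positivity
  have ht1 : (1 : ℚ) / p ^ k ≤ 1 := (div_le_one (pow_pos hp0 k)).2 (one_le_pow₀ (by linarith))
  have key := hasWeightTable_definingCode hp hK₁ hK₂ (by omega) f hα e l hf hR hR1
    (Finset.univ.filter fun a : ZMod p => τ * quadraticChar (ZMod p) a = 1)
    (Finset.univ.filter fun a : ZMod p => τ * quadraticChar (ZMod p) a = -1)
    ((1 : ℤ) / p ^ k) ((-1 : ℤ) / p ^ k)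
    (fun a ha => hA 1 a (Finset.mem_filter.1 ha).2)
    (fun a ha => hA (-1) a (Finset.mem_filter.1 ha).2)
    (fun a h₂ h₃ => by
      have h4 : τ * quadraticChar (ZMod p) a = 0 := by
        simp only [Finset.mem_filter, Finset.mem_univ, true_and] at h₂ h₃
        rcases hτ with h | h <;> rw [h] at h₂ h₃ ⊢ <;>
        rcases quadraticChar_isQuadratic (ZMod p) a with h' | h' | h' <;> rw [h'] at h₂ h₃ ⊢ <;>
        simp at h₂ h₃ ⊢
      rw [hdev, h4, mul_zero])
    (by push_cast; exact ht0.ne')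
    (by push_cast; rw [neg_div]; exact neg_ne_zero.2 ht0.ne')
    (by push_cast; rw [neg_div]; exact (by linarith : -(1 / (p : ℚ) ^ k) < 1 / p ^ k).ne')
    (by push_cast; linarith)
    (by push_cast; rw [neg_div]; linarith)
    (exists_nat_eq_codeWeight (Fact.out : p.Prime).pos (by omega) 1 (by push_cast; linarith))
    (exists_nat_eq_codeWeight (Fact.out : p.Prime).pos (by omega) (-1)
      (by push_cast; rw [neg_div]; linarith))
  dsimp only at key
  rw [c₂, c₃] at key
  push_cast at key
  rw [neg_div, one_div] at key
  obtain ⟨htable, hdim, h3⟩ := key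
  refine ⟨?_, hdim, fun hk => h3 ?_ ?_ ?_⟩
  · convert htable using 1
    simp only [oddTable, codeWeight, Nat.add_sub_cancel, Nat.mul_div_cancel_left k two_pos,
      List.cons.injEq, Prod.mk.injEq, and_true, true_and]
    refine ⟨⟨?_, ?_⟩, ?_, ?_, ?_⟩ <;> ring
  · have h4 : (p : ℚ) ^ (2 * k) * p ^ 2 ≤ p ^ (s₁ + s₂) := by
      rw [← pow_add]
      exact pow_le_pow_right₀ (by linarith) (by omega)
    have h5 : (1 : ℚ) ≤ p ^ (2 * k) := one_le_pow₀ (by linarith)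
    have h6 : (0 : ℚ) < p ^ (2 * k) * (2 * p - 1) - 1 := by nlinarith
    refine ne_of_gt (lt_of_lt_of_le h6 ?_)
    linear_combination h4
  · have : (0 : ℚ) < p - 1 := by linarith
    positivity
  · have h4 : (0 : ℚ) < p - 1 := by linarith
    have h5 : ((p : ℚ) ^ k)⁻¹ < 1 := inv_lt_one_of_one_lt₀ (one_lt_pow₀ (by linarith) (by omega))
    have h6 : 0 < 1 + -((p : ℚ) ^ k)⁻¹ := by linarith
    positivity

theorem weights_of_even_rank (hp : p ≠ 2) (hK₁ : Fintype.card K₁ = p ^ s₁)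
    (hK₂ : Fintype.card K₂ = p ^ s₂) (hs₂ : 1 ≤ s₂) (f : QuadraticForm (ZMod p) K₁) {α : K₂}
    (hα : α ≠ 0) (e : (Fin s₁ → ZMod p) ≃ₗ[ZMod p] K₁) (l : Fin s₁ → ZMod p)
    (hf : ∀ z, f (e z) = ∑ i, l i * z i ^ 2) {R : ℕ}
    (hR : (Finset.univ.filter fun i => l i ≠ 0).card = R) (hReven : Even R) (hR1 : 1 ≤ R) :
    HasWeightTable (definingCode (p := p) (definingSet f α))
        (evenTable p (s₁ + s₂) R (quadraticChar (ZMod p) (∏ i with l i ≠ 0, l i))) ∧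
      Module.finrank (ZMod p) (definingCode (p := p) (definingSet f α)) = s₁ + s₂ ∧
      IsTWeightCode (definingCode (p := p) (definingSet f α)) 3 := by
  have hp3 : (3 : ℚ) ≤ p := by
    have := (Fact.out : p.Prime).two_le
    exact_mod_cast (by omega : 3 ≤ p)
  have hp0 : (0 : ℚ) < p := by linarith
  have hRs : R ≤ s₁ := by
    rw [← hR]
    simpa using Finset.card_filter_le (Finset.univ : Finset (Fin s₁)) (fun i => l i ≠ 0)
  obtain ⟨k, rfl⟩ := hReven
  rw [← two_mul] at *
  set d := ∏ i with l i ≠ 0, l i with hd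
  have hd0 : d ≠ 0 := Finset.prod_ne_zero_iff.2 fun i hi => (Finset.mem_filter.1 hi).2
  set σ : ℤ := quadraticChar (ZMod p) d * quadraticChar (ZMod p) (-1) ^ k with hσdef
  have hη : quadraticChar (ZMod p) (-1) = 1 ∨ quadraticChar (ZMod p) (-1) = -1 :=
    quadraticChar_dichotomy (neg_ne_zero.2 one_ne_zero)
  have hσ : σ = 1 ∨ σ = -1 := by
    rw [hσdef, ← map_pow, ← map_mul]
    exact quadraticChar_dichotomy
      (mul_ne_zero hd0 (pow_ne_zero _ (neg_ne_zero.2 one_ne_zero)))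
  have hdev : ∀ a, gaussDeviation (ZMod p) (2 * k) d a =
      p ^ k * (σ * if a = 0 then (p : ℤ) - 1 else -1) := by
    intro a
    rw [gaussDeviation, if_pos (even_two_mul k), hσdef, ZMod.card,
      Nat.mul_div_cancel_left k two_pos, mul_pow]
    ring
  have hA : ∀ (j : ℤ) (a), (σ * if a = (0 : ZMod p) then (p : ℤ) - 1 else -1) = j →
      (gaussDeviation (ZMod p) (2 * k) d a : ℚ) = p ^ (2 * k) * (j / p ^ k) := by
    intro j a h
    rw [hdev, h]
    push_cast
    field_simp
    ring
  -- `ε (p*)^(-k)` is `± p^(-k)`, as the quadratic character is its own inverse.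
  have ht : ((quadraticChar (ZMod p) d : ℤ) : ℚ) * (pStar p ^ k)⁻¹ = σ / p ^ k := by
    rw [← quadraticChar_neg_one_mul_eq_pStar hp, mul_pow, mul_inv, hσdef]
    have h1 : ((((quadraticChar (ZMod p) (-1) : ℤ) : ℚ)) ^ k)⁻¹ =
        ((quadraticChar (ZMod p) (-1) : ℤ) : ℚ) ^ k := by
      rw [← inv_pow]
      rcases hη with h | h <;> rw [h] <;> norm_num
    rw [h1]
    push_cast
    ring
  have hpk : (p : ℚ) ≤ p ^ k := le_self_pow₀ (by linarith) (by omega)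
  have hσ0 : (σ : ℚ) ≠ 0 := by rcases hσ with h | h <;> rw [h] <;> norm_num
  have ht0 : (σ : ℚ) / p ^ k ≠ 0 := div_ne_zero hσ0 (pow_pos hp0 k).ne'
  have hu0 : (0 : ℚ) < 1 / p ^ k := by positivity
  have hu1 : (p : ℚ) * (1 / p ^ k) ≤ 1 := by
    rw [mul_one_div]
    exact (div_le_one (pow_pos hp0 k)).2 hpk
  have htu : (σ : ℚ) / p ^ k = 1 / p ^ k ∨ (σ : ℚ) / p ^ k = -(1 / p ^ k) := by
    rcases hσ with h | h <;> rw [h]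
    · left; norm_num
    · right; push_cast; ring
  set t : ℚ := σ / p ^ k with htdef
  have hub : (1 : ℚ) / p ^ k ≤ 1 / 3 := by nlinarith
  have hρ₂ : ((((p : ℤ) - 1) * σ : ℤ) : ℚ) / p ^ k = (p - 1) * t := by
    rw [htdef]; push_cast; ring
  have hρ₃ : ((-σ : ℤ) : ℚ) / p ^ k = -t := by
    rw [htdef]; push_cast; ring
  have ht1 : t < 1 := by rcases htu with h | h <;> rw [h] <;> linarith
  have ht2 : -1 < t := by rcases htu with h | h <;> rw [h] <;> linarith
  have ht3 : -1 < (p - 1) * t := by rcases htu with h | h <;> rw [h] <;> nlinarith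
  have hlt₂ : (p - 1) * t < p - 1 := by nlinarith
  have hlt₃ : -t < p - 1 := by linarith
  have key := hasWeightTable_definingCode hp hK₁ hK₂ (by omega) f hα e l hf hR hR1
    {0} (Finset.univ.erase 0) ((p - 1) * t) (-t)
    (fun a ha => by
      rw [← hρ₂]
      refine hA _ a ?_
      rw [if_pos (Finset.mem_singleton.1 ha), mul_comm])
    (fun a ha => by
      rw [← hρ₃]
      refine hA _ a ?_
      rw [if_neg (Finset.ne_of_mem_erase ha), mul_neg_one])
    (fun a h₂ h₃ => absurd (Finset.mem_erase.2 ⟨by simpa using h₂, Finset.mem_univ a⟩) h₃)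
    (mul_ne_zero (by linarith) ht0) (neg_ne_zero.2 ht0)
    (fun h => ht0 (by
      have : (p : ℚ) * t = 0 := by linear_combination h
      exact (mul_eq_zero.1 this).resolve_left hp0.ne'))
    hlt₂ hlt₃
    (by
      rw [← hρ₂] at hlt₂ ⊢
      exact exists_nat_eq_codeWeight (Fact.out : p.Prime).pos (by omega) _ hlt₂)
    (by
      rw [← hρ₃] at hlt₃ ⊢
      exact exists_nat_eq_codeWeight (Fact.out : p.Prime).pos (by omega) _ hlt₃)
  dsimp only at key
  rw [Finset.card_singleton, Finset.card_erase_of_mem (Finset.mem_univ _), Finset.card_univ,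
    ZMod.card, Nat.cast_sub (Fact.out : p.Prime).one_lt.le, Nat.cast_one, mul_one] at key
  obtain ⟨htable, hdim, h3⟩ := key
  obtain ⟨n, hn⟩ : ∃ n, 2 * k = n + 1 := Nat.exists_eq_add_of_le' hR1
  rw [hn, Nat.add_sub_cancel] at htable h3
  have hq : (0 : ℚ) < p - 1 := by linarith
  refine ⟨?_, hdim, h3 ?_ ?_ ?_⟩
  · convert htable using 1
    rw [evenTable, Nat.mul_div_cancel_left k two_pos]
    simp only [ht]
    rw [hn]
    simp only [codeWeight, Nat.add_sub_cancel, List.cons.injEq, Prod.mk.injEq, and_true, true_and]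
    refine ⟨⟨?_, ?_⟩, ?_, ?_, ?_⟩ <;> ring
  · have h4 : (p : ℚ) ^ n * p ^ 2 ≤ p ^ (s₁ + s₂) := by
      rw [← pow_add]
      exact pow_le_pow_right₀ (by linarith) (by omega)
    have h5 : (1 : ℚ) ≤ p ^ n := one_le_pow₀ (by linarith)
    have h6 : (0 : ℚ) < p ^ n * p - 1 := by nlinarith
    refine ne_of_gt (lt_of_lt_of_le h6 ?_)
    linear_combination h4
  · have h4 : 0 < 1 + (p - 1) * t := by linarith
    positivity
  · have h4 : 0 < 1 + -t := by linarith
    positivity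

end Evaluation

end

theorem mainTheorem2 (p : ℕ) [Fact p.Prime] (hp : p ≠ 2) (s₁ s₂ : ℕ)
    (K₁ K₂ : Type*) [Field K₁] [Field K₂] [Fintype K₁] [Fintype K₂]
    [Algebra (ZMod p) K₁] [Algebra (ZMod p) K₂]
    (hK₁ : Fintype.card K₁ = p ^ s₁) (hK₂ : Fintype.card K₂ = p ^ s₂)
    (v : Module.Basis (Fin s₁) (ZMod p) K₁)
    (f : QuadraticForm (ZMod p) K₁) (hf : f ≠ 0) (α : K₂) (hα : α ≠ 0) :
    (definingSet f α).card = p ^ (s₁ + s₂ - 1) - 1 ∧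
    Module.finrank (ZMod p) (definingCode (p := p) (definingSet f α)) = s₁ + s₂ ∧
    (Odd (formRank f v) →
      HasWeightTable (definingCode (p := p) (definingSet f α))
        (oddTable p (s₁ + s₂) (formRank f v))) ∧
    (Even (formRank f v) →
      HasWeightTable (definingCode (p := p) (definingSet f α))
        (evenTable p (s₁ + s₂) (formRank f v) (formSign f v))) ∧
    (2 ≤ formRank f v →
      IsTWeightCode (definingCode (p := p) (definingSet f α)) 3) := by
  classical
  have hs₂ : 1 ≤ s₂ := by
    rw [Nat.one_le_iff_ne_zero]
    rintro rfl
    have := Fintype.one_lt_card (α := K₂)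
    rw [hK₂, pow_zero] at this
    exact lt_irrefl _ this
  have hsign : IsMatrixSign (formMatrix f v) (formSign f v) := by
    have h := exists_isMatrixSign hp f v
    rw [formSign, dif_pos h]
    exact h.choose_spec
  obtain ⟨e, l, hfe, hR, hε⟩ := exists_diagonal_coordinates hp f v hsign
  have hR1 : 1 ≤ formRank f v := by
    rw [← hR, Nat.one_le_iff_ne_zero, Finset.card_ne_zero]
    by_contra hempty
    refine hf (QuadraticMap.ext fun x => ?_)
    obtain ⟨z, rfl⟩ := e.surjective x
    rw [hfe, zero_apply]
    refine Finset.sum_eq_zero fun i _ => ?_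
    have hi : l i = 0 := by
      by_contra hi
      exact hempty ⟨i, Finset.mem_filter.2 ⟨Finset.mem_univ i, hi⟩⟩
    rw [hi, zero_mul]
  have hlength : (definingSet f α).card = p ^ (s₁ + s₂ - 1) - 1 := by
    rw [definingSet_eq, Finset.card_erase_of_mem (zero_mem_zeroLocus f α 0)]
    congr 1
    have h := card_zeroLocus_zero f hα
    rw [hK₁, hK₂, ← pow_add, ← Nat.sub_add_cancel (show 1 ≤ s₁ + s₂ by omega), pow_succ] at h
    exact Nat.eq_of_mul_eq_mul_right (Fact.out : p.Prime).pos h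
  refine ⟨hlength, ?_⟩
  rcases Nat.even_or_odd (formRank f v) with hev | hodd
  · obtain ⟨h1, h2, h3⟩ := weights_of_even_rank hp hK₁ hK₂ hs₂ f hα e l hfe hR hev hR1
    rw [← hε] at h1
    exact ⟨h2, fun h => absurd hev (Nat.not_even_iff_odd.2 h), fun _ => h1, fun _ => h3⟩
  · obtain ⟨h1, h2, h3⟩ := weights_of_odd_rank hp hK₁ hK₂ hs₂ f hα e l hfe hR hodd
    exact ⟨h2, fun _ => h1, fun h => absurd h (Nat.not_even_iff_odd.2 hodd), h3⟩
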